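/- Let $q$ be a prime power, $\mathbb F_q$ the field with $q$ elements and $n\ge 0$. Let $\Phi_q$ be the set of monic irreducible polynomials in $\mathbb F_q[X]$ and $\mathcal P$ the set of integer partitions. For $g\in \mathrm{GL}_n(\mathbb F_q)$, the $\mathbb F_q[X]$-module $\mathbb F_q^n$ on which $X$ acts as $g$ is isomorphic to $\bigoplus_{\phi\in\Phi_q}\bigoplus_{j}\mathbb F_q[X]/(\phi^{\lambda_{\phi,j}})$ for a unique finitely supported map $f:\Phi_q\to\mathcal P$, $\phi\mapsto(\lambda_{\phi,1}\ge\lambda_{\phi,2}\ge\cdots)$. The type of (the conjugacy class of) $g$ is the sequence $\mathbf t=(\mathbf t_d)_{d\ge1}$, where $\mathbf t_d$ is the multiset of the nonempty partitions $f(\phi)$ with $\deg\phi=d$. For a partition $\nu$ with $m_k$ parts equal to $k$, and $d\ge 1$, put $$c_d(\nu)=\prod_{k\ge1}\prod_{i=1}^{m_k}\bigl(q^{d_k d}-q^{(d_k-i)d}\bigr),\qquad d_k=\sum_{j\le k} j\,m_j+k\sum_{j>k}m_j .$$ For a type $\mathbf t$, let $m_{d,\nu}$ be the multiplicity of $\nu$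 in $\mathbf t_d$, let $I_d$ be the number of monic irreducible polynomials of degree $d$ in $\mathbb F_q[X]$ other than $X$, and put $$N_{\mathbf t}=\prod_{d\ge1}\binom{I_d}{|\mathbf t_d|}\frac{|\mathbf t_d|!}{\prod_\nu m_{d,\nu}!}.$$ For a partition $\lambda=(\lambda_1,\dots,\lambda_r)$ of $n$, let $\mathrm{GL}_\lambda(\mathbb F_q)=\prod_i\mathrm{GL}_{\lambda_i}(\mathbb F_q)$, embedded in $\mathrm{GL}_n(\mathbb F_q)$ as block-diagonal matrices. Theorem. (1) For every type $\mathbf t$ of a conjugacy class in $\mathrm{GL}_n(\mathbb F_q)$, the number of conjugacy classes of type $\mathbf t$ in $\mathrm{GL}_n(\mathbb F_q)$ is $N_{\mathbf t}$. (2) For every partition $\lambda$ of $n$, the number of elements of $\mathrm{GL}_\lambda(\mathbb F_q)$ in a conjugacy class $C$ of $\mathrm{GL}_n(\mathbb F_q)$ depends only on $\lambda$ and the type $\mathbf t$ of $C$; denote it by $a_{\mathbf t,\lambda}$. (3) For all partitions $\lambda,\mu$ of $n$, $$|\mathrm{GL}_\lambda(\mathbb F_q)\backslash\mathrm{GL}_n(\mathbb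 F_q)/\mathrm{GL}_\mu(\mathbb F_q)|=\frac1{|\mathrm{GL}_\lambda(\mathbb F_q)|\cdot|\mathrm{GL}_\mu(\mathbb F_q)|}\sum_{\mathbf t}N_{\mathbf t}\,a_{\mathbf t,\lambda}\,a_{\mathbf t,\mu}\prod_{d\ge1}\prod_{\nu\in\mathbf t_d}c_d(\nu),$$ where the sum is over all distinct types of conjugacy classes in $\mathrm{GL}_n(\mathbb F_q)$. -/

import Mathlib

open scoped DirectSum Polynomial

noncomputable section

namespace GLDoubleCosets

/-- An integer partition (of any size): a finite multiset of positive integers, its parts. -/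
abbrev IntPartition : Type := Multiset ℕ+

/-- The multiplicity `m_k` of `k` as a part of `p`. -/
def IntPartition.mult (p : IntPartition) (k : ℕ) : ℕ :=
  (p.map (fun i : ℕ+ => (i : ℕ))).count k

/-- The size `|p|`, the sum of the parts of `p`. -/
def IntPartition.size (p : IntPartition) : ℕ :=
  (p.map (fun i : ℕ+ => (i : ℕ))).sum

/-- `d_k = m_1 + 2 m_2 + ⋯ + k m_k + k (m_{k+1} + ⋯ + m_{|p|})`. -/
def IntPartition.dk (p : IntPartition) (k : ℕ) : ℕ :=
  ∑ j ∈ Finset.Icc 1 k, j * p.mult j + k * ∑ j ∈ Finset.Icc (k + 1) p.size, p.mult j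

/-- `c_d(p) = ∏_{k ≥ 1} ∏_{i = 1}^{m_k} (q^{d_k d} - q^{(d_k - i) d})`.
Parts are at most `|p|`, so the factors with `k > |p|` are empty products; `i ≤ m_k ≤ d_k`, so the
subtraction in the exponent does not truncate. -/
def cd (q d : ℕ) (p : IntPartition) : ℚ :=
  ∏ k ∈ Finset.Icc 1 p.size, ∏ i ∈ Finset.Icc 1 (p.mult k),
    ((q : ℚ) ^ (p.dk k * d) - (q : ℚ) ^ ((p.dk k - i) * d))

/-- The set `Φ_q` of monic irreducible polynomials over `K`. -/
abbrev MonicIrred (K : Type*) [Field K] : Type _ :=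
  {φ : K[X] // φ.Monic ∧ Irreducible φ}

/-- `f`, assigning to each monic irreducible polynomial a partition (empty for all but finitely
many), describes the matrix `M`: the `K[X]`-module `K^n` on which `X` acts as `M` is isomorphic
to `⨁_φ ⨁_j K[X] / (φ ^ λ_{φ,j})`, where the `λ_{φ,j}` are the parts of `f φ`. -/
def IsClassMap {K : Type*} [Field K] {n : ℕ} (M : Matrix (Fin n) (Fin n) K)
    (f : MonicIrred K →₀ IntPartition) : Prop :=
  Nonempty (Module.AEval' (Matrix.toLin' M) ≃ₗ[K[X]]
    ⨁ φ : MonicIrred K, ⨁ j : (f φ).ToType, K[X] ⧸ Ideal.span {φ.1 ^ (j.1 : ℕ)})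

/-- The map from monic irreducible polynomials to partitions that describes the matrix `M`
(it exists and is unique by the structure theorem over the principal ideal domain `K[X]`). -/
def classMap {K : Type*} [Field K] {n : ℕ} (M : Matrix (Fin n) (Fin n) K) :
    MonicIrred K →₀ IntPartition :=
  Classical.epsilon (IsClassMap M)

/-- The type of a conjugacy class: for each degree `d`, a multiset of (nonempty) partitions. -/
abbrev ClassType : Type := ℕ → Multiset IntPartition

/-- The type of a map `f`: its degree `d` term is the multiset of the nonempty partitions `f φ`,
for `φ` monic irreducible of degree `d`. -/
def typeOfMap {K : Type*} [Field K] (f : MonicIrred K →₀ IntPartition) : ClassType :=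
  fun d => (f.support.filter (fun φ => φ.1.natDegree = d)).val.map f

/-- The type of the conjugacy class of `g` in `GL_n(K)`. -/
def classType {K : Type*} [Field K] {n : ℕ} (g : GL (Fin n) K) : ClassType :=
  typeOfMap (classMap (g : Matrix (Fin n) (Fin n) K))

/-- The finite set of all types of conjugacy classes in `GL_n(K)`. -/
def classTypes (K : Type*) [Field K] [Finite K] (n : ℕ) : Finset ClassType :=
  (Set.finite_range (classType : GL (Fin n) K → ClassType)).toFinset

/-- `I_d`, the number of monic irreducible polynomials of degree `d` over `K` other than `X`. -/
def numIrred (K : Type*) [Field K] (d : ℕ) : ℕ :=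
  Nat.card {φ : K[X] // φ.Monic ∧ Irreducible φ ∧ φ.natDegree = d ∧ φ ≠ Polynomial.X}

/-- `N_t = ∏_{d ≥ 1} (I_d choose |t_d|) * |t_d|! / ∏_p m_{d,p}!`, where `m_{d,p}` is the
multiplicity of `p` in `t_d`. For a type `t` of a class in `GL_n(K)`, `t_d` is empty for `d > n`. -/
def numClasses (K : Type*) [Field K] (n : ℕ) (t : ClassType) : ℚ :=
  ∏ d ∈ Finset.Icc 1 n, (((numIrred K d).choose (t d).card : ℚ) *
    (((t d).card.factorial : ℚ) / ∏ p ∈ (t d).toFinset, (((t d).count p).factorial : ℚ)))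

/-- `∏_{d ≥ 1} ∏_{p ∈ t_d} c_d(p)`. -/
def centralizerOrder (q n : ℕ) (t : ClassType) : ℚ :=
  ∏ d ∈ Finset.Icc 1 n, ((t d).map (cd q d)).prod

/-- The parts `λ_1 ≥ ⋯ ≥ λ_r` of a partition of `n`, as a composition of `n`. -/
def toComposition {n : ℕ} (ν : n.Partition) : Composition n where
  blocks := ν.parts.sort (· ≥ ·)
  blocks_pos := fun h => ν.parts_pos ((Multiset.mem_sort _).1 h)
  blocks_sum := by
    rw [← Multiset.sum_coe, Multiset.sort_eq, ν.parts_sum]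

/-- The block-diagonal embedding `GL_{λ_1}(K) × ⋯ × GL_{λ_r}(K) → GL_n(K)`. -/
def blockEmbedding (K : Type*) [Field K] {n : ℕ} (c : Composition n) :
    ((i : Fin c.length) → GL (Fin (c.blocksFun i)) K) →* GL (Fin n) K :=
  (Units.map (((Matrix.reindexRingEquiv K c.blocksFinEquiv).toRingHom.comp
    (Matrix.blockDiagonal'RingHom (fun i => Fin (c.blocksFun i)) K)).toMonoidHom)).comp
    (MulEquiv.piUnits.symm.toMonoidHom)

/-- The subgroup `GL_ν(K)` of `GL_n(K)`, for `ν` a partition of `n`. -/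
def GLpart (K : Type*) [Field K] {n : ℕ} (ν : n.Partition) : Subgroup (GL (Fin n) K) :=
  (blockEmbedding K (toComposition ν)).range

end GLDoubleCosets

end

/-! ### Equivalences built fibrewise, and combinatorics of partitions -/

noncomputable section
namespace GLDoubleCosets

/-! A matrix makes `K^n` a torsion `K[X]`-module, hence a sum of modules `K[X]/(φ^j)` recorded by a
map `f` from monic irreducibles to partitions. The orders of the `φ^k`-torsion submodules are
`q^(deg φ * d_k(f φ))`, and the numbers `d_k` determine a partition, so `f` is unique. Two matrices
are conjugate exactly when their maps agree (`isConj_iff_classMap_eq`). The maps coming from `GL_n`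
are those of total size `n` that vanish at `X`, and counting such maps degree by degree gives (1).

The centralizer order is the number of injective endomorphisms of the finite module. These are
counted by adding cyclic summands one at a time, largest parts first: the number of ways to extend
an injection over a new summand does not depend on the injection (`card_injHom_prod`), and the
resulting product is `∏ c_d` (`card_injHom_partModule_self`).

For (2), two maps of the same type differ by a degree-preserving permutation `σ` of the irreducibles
fixing `X`. Class sizes depend only on the type, so `σ` lifts to a bijection of every `GL_m(K)` with
itself that relabels class maps. The class map of a block-diagonal matrix is the sum of those of its
blocks, so applying these bijections blockwise matches the two intersections with `GL_λ`.

For (3), Burnside's lemma for `GL_λ × GL_μ` acting on `GL_n` gives a sum over pairs `(h, l)` of the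
number of `x` with `x l = h x`. This is zero unless `h` and `l` are conjugate, and otherwise is the
centralizer order. Grouping pairs by class, and classes by type, gives the formula. -/

theorem exists_equiv_comp_eq {α β γ : Type*} (u : α → γ) (v : β → γ)
    [∀ c, Finite {a // u a = c}] [∀ c, Finite {b // v b = c}]
    (h : ∀ c, Nat.card {a // u a = c} = Nat.card {b // v b = c}) :
    ∃ e : α ≃ β, ∀ a, v (e a) = u a := by
  -- Arbitrary bijections between corresponding fibres are chosen and glued.
  have e := fun c => (Finite.card_eq.1 (h c)).some
  refine ⟨(Equiv.sigmaFiberEquiv u).symm.trans ((Equiv.sigmaCongrRight fun c =>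
    (e c)).trans (Equiv.sigmaFiberEquiv v)), fun a => (e (u a) ⟨a, rfl⟩).2⟩

namespace IntPartition

/-- The number of parts of `p` greater than `k`. -/
def numGt (p : IntPartition) (k : ℕ) : ℕ := p.countP (fun j : ℕ+ => k < (j : ℕ))

theorem mult_eq_countP (p : IntPartition) (k : ℕ) :
    p.mult k = p.countP (fun j : ℕ+ => (j : ℕ) = k) := by
  rw [mult, Multiset.count_map, Multiset.countP_eq_card_filter]
  simp only [eq_comm]

theorem mult_coe (p : IntPartition) (k : ℕ+) : p.mult k = p.count k :=
  Multiset.count_map_eq_count' _ _ PNat.coe_injective _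

theorem mult_cons (j : ℕ+) (p : IntPartition) (k : ℕ) :
    mult (j ::ₘ p) k = p.mult k + if (j : ℕ) = k then 1 else 0 := by
  simp only [mult_eq_countP, Multiset.countP_cons]

theorem numGt_cons (j : ℕ+) (p : IntPartition) (k : ℕ) :
    numGt (j ::ₘ p) k = p.numGt k + if k < (j : ℕ) then 1 else 0 := by
  simp only [numGt, Multiset.countP_cons]

theorem le_size {p : IntPartition} {j : ℕ+} (h : j ∈ p) : (j : ℕ) ≤ p.size :=
  Multiset.le_sum_of_mem (Multiset.mem_map_of_mem _ h)

theorem mult_eq_zero {p : IntPartition} {k : ℕ} (h : ∀ j ∈ p, (j : ℕ) ≠ k) : p.mult k = 0 := by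
  rw [mult_eq_countP, Multiset.countP_eq_zero]
  exact h

/-- The bound `B` replaces the size of `p`, which would change during the induction. -/
theorem sum_map_min_eq (p : IntPartition) (k B : ℕ) (hB : ∀ j ∈ p, (j : ℕ) ≤ k + B) :
    (p.map (fun j : ℕ+ => min (j : ℕ) k)).sum =
      ∑ j ∈ Finset.Icc 1 k, j * p.mult j + k * ∑ j ∈ Finset.Icc (k + 1) (k + B), p.mult j := by
  induction p using Multiset.induction_on with
  | empty => simp [mult]
  | cons a p ih =>
    rw [Multiset.map_cons, Multiset.sum_cons, ih fun j hj => hB j (Multiset.mem_cons_of_mem hj)]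
    simp only [mult_cons, mul_add, Finset.sum_add_distrib, mul_ite, mul_one, mul_zero,
      Finset.sum_ite_eq, Finset.mem_Icc]
    have h1 := a.pos
    have h2 := hB a (Multiset.mem_cons_self _ _)
    rcases le_or_gt (a : ℕ) k with h | h
    · rw [if_pos ⟨h1, h⟩, if_neg (by omega), min_eq_left h]
      omega
    · rw [if_neg (by omega), if_pos ⟨h, h2⟩, min_eq_right h.le]
      omega

/-- In this form `d_k` is visibly additive in `p`, and `min j k` is the length of the `φ^k`-torsion
of `K[X]/(φ^j)`. -/
theorem dk_eq (p : IntPartition) (k : ℕ) :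
    p.dk k = (p.map (fun j : ℕ+ => min (j : ℕ) k)).sum := by
  rw [sum_map_min_eq p k p.size fun j hj => (le_size hj).trans (Nat.le_add_left _ _), dk]
  congr 2
  refine Finset.sum_subset (Finset.Icc_subset_Icc_right (Nat.le_add_left _ _)) fun x hx hx' => ?_
  refine mult_eq_zero fun j hj hjx => hx' ?_
  have := le_size hj
  simp only [Finset.mem_Icc] at hx ⊢
  omega

theorem dk_zero_right (p : IntPartition) : p.dk 0 = 0 := by
  simp [dk]

theorem dk_add (p p' : IntPartition) (k : ℕ) : (p + p').dk k = p.dk k + p'.dk k := by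
  simp [dk_eq]

theorem dk_singleton (j : ℕ+) (k : ℕ) : dk {j} k = min (j : ℕ) k := by
  simp [dk_eq]

theorem dk_succ (p : IntPartition) (k : ℕ) : p.dk (k + 1) = p.dk k + p.numGt k := by
  simp only [dk_eq]
  induction p using Multiset.induction_on with
  | empty => simp [numGt]
  | cons a p ih =>
    rw [Multiset.map_cons, Multiset.sum_cons, ih, Multiset.map_cons, Multiset.sum_cons, numGt_cons]
    split_ifs <;> omega

theorem numGt_eq (p : IntPartition) (k : ℕ) :
    p.numGt k = p.mult (k + 1) + p.numGt (k + 1) := by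
  induction p using Multiset.induction_on with
  | empty => simp [numGt, mult]
  | cons a p ih =>
    simp only [numGt_cons, mult_cons, ih]
    split_ifs <;> omega

theorem numGt_zero_right (p : IntPartition) : p.numGt 0 = Multiset.card p := by
  rw [numGt, Multiset.countP_eq_card]
  exact fun j _ => j.pos

theorem dk_one (p : IntPartition) : p.dk 1 = Multiset.card p := by
  rw [dk_succ, dk_zero_right, numGt_zero_right, zero_add]

/-- First differences of `d_k` count the parts greater than `k`; differences of those counts are the
multiplicities. -/
theorem ext_dk {p p' : IntPartition} (h : ∀ k, p.dk k = p'.dk k) : p = p' := by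
  have h1 : ∀ k, p.numGt k = p'.numGt k := fun k => by
    have := dk_succ p k
    have := dk_succ p' k
    have := h k
    have := h (k + 1)
    omega
  ext k
  obtain ⟨m, hm⟩ : ∃ m, (k : ℕ) = m + 1 := ⟨k - 1, (Nat.succ_pred_eq_of_pos k.pos).symm⟩
  rw [← mult_coe, ← mult_coe, hm]
  have := numGt_eq p m
  have := numGt_eq p' m
  have := h1 m
  have := h1 (m + 1)
  omega

/-- A product over the parts of `p`, in decreasing order: the factor for a part `k` preceded by `i`
other parts is `F k i`. -/
def partProd {A : Type*} [CommMonoid A] (F : ℕ → ℕ → A) (B : ℕ) (p : IntPartition) : A :=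
  ∏ k ∈ Finset.Icc 1 B, ∏ i ∈ Finset.range (p.mult k), F k (p.numGt k + i)

theorem partProd_zero {A : Type*} [CommMonoid A] (F : ℕ → ℕ → A) (B : ℕ) :
    partProd F B 0 = 1 := by
  simp [partProd, mult]

/-- A smallest part can be placed last, after all `card p` others, so it adds one factor and leaves
the earlier ones alone. -/
theorem partProd_cons {A : Type*} [CommMonoid A] (F : ℕ → ℕ → A) (B : ℕ) (p : IntPartition)
    (a : ℕ+) (ha : ∀ j ∈ p, a ≤ j) (haB : (a : ℕ) ≤ B) :
    partProd F B (a ::ₘ p) = partProd F B p * F a (Multiset.card p) := by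
  have hmem : (a : ℕ) ∈ Finset.Icc 1 B := Finset.mem_Icc.2 ⟨a.pos, haB⟩
  rw [partProd, partProd, ← Finset.mul_prod_erase _ _ hmem, ← Finset.mul_prod_erase _ _ hmem,
    mult_cons, if_pos rfl, Finset.prod_range_succ, numGt_cons, if_neg (lt_irrefl _), add_zero]
  have h1 : p.numGt a + p.mult a = Multiset.card p := by
    obtain ⟨m, hm⟩ : ∃ m, (a : ℕ) = m + 1 := ⟨a - 1, (Nat.succ_pred_eq_of_pos a.pos).symm⟩
    rw [hm, add_comm, ← numGt_eq, numGt, Multiset.countP_eq_card]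
    intro j hj
    have : (a : ℕ) ≤ j := ha j hj
    omega
  rw [h1, mul_right_comm]
  congr 1
  congr 1
  refine Finset.prod_congr rfl fun k hk => ?_
  rw [mult_cons, if_neg (Finset.ne_of_mem_erase hk).symm, add_zero, numGt_cons]
  -- For `k < a` the offset `numGt` does change, but no part equals `k` and the product is empty.
  rcases lt_or_ge k (a : ℕ) with h | h
  · rw [mult_eq_zero fun j hj hjk => absurd (show (a : ℕ) ≤ j from ha j hj) (by omega)]
    simp
  · rw [if_neg (by omega), add_zero]

end IntPartition

/-- Removing a smallest part at each step means that parts at each `φ` are added in decreasing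
order, as both `partProd_cons` and the count of injections require. -/
theorem finsupp_multiset_induction {Φ : Type*} {P : (Φ →₀ IntPartition) → Prop} (h0 : P 0)
    (hs : ∀ (f : Φ →₀ IntPartition) (φ : Φ) (k : ℕ+), (∀ j ∈ f φ, k ≤ j) → P f →
      P (f + Finsupp.single φ {k})) (f : Φ →₀ IntPartition) : P f := by
  classical
  induction hn : f.sum (fun _ p => Multiset.card p) using Nat.strong_induction_on generalizing f with
  | _ n ih =>
    by_cases hf : f = 0
    · rw [hf]; exact h0
    obtain ⟨φ, hφ⟩ := Finsupp.ne_iff.1 hf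
    obtain ⟨k, hk, hmin⟩ := Multiset.exists_min_image (id : ℕ+ → ℕ+) (s := f φ) hφ
    obtain ⟨p, hp⟩ := Multiset.exists_cons_of_mem hk
    have hfe : f = f.update φ p + Finsupp.single φ {k} := by
      ext1 ψ
      by_cases h : ψ = φ
      · subst h
        simp [hp, ← Multiset.singleton_add, add_comm]
      · simp [h, Function.update_of_ne]
    rw [hfe]
    refine hs _ _ _ (fun j hj => ?_) (ih _ ?_ _ rfl)
    · refine hmin j ?_
      rw [hp]
      simp at hj
      exact Multiset.mem_cons_of_mem hj
    · rw [← hn]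
      conv_rhs => rw [hfe]
      rw [Finsupp.sum_add_index' (by simp) (by simp), Finsupp.sum_single_index (by simp)]
      simp

end GLDoubleCosets
end

/-! ### Torsion modules as products of prime-power cyclic modules -/

noncomputable section
namespace GLDoubleCosets

section ClassModule

variable {K : Type*} [Field K]

/-- The module `⨁_φ ⨁_j K[X] / (φ ^ λ_{φ,j})` attached to `f`. -/
abbrev ClassModule (f : MonicIrred K →₀ IntPartition) : Type _ :=
  ⨁ φ : MonicIrred K, ⨁ j : (f φ).ToType, K[X] ⧸ Ideal.span {φ.1 ^ (j.1 : ℕ)}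

/-- The cyclic module `K[X] / (φ ^ k)`. -/
abbrev PrimePowerModule (x : MonicIrred K × ℕ+) : Type _ :=
  K[X] ⧸ Ideal.span {x.1.1 ^ (x.2 : ℕ)}

/-- The index set of the cyclic summands of `ClassModule f`. -/
abbrev PartIndex (f : MonicIrred K →₀ IntPartition) : Type _ :=
  Σ φ : MonicIrred K, (f φ).ToType

/-- The prime power belonging to a cyclic summand of `ClassModule f`. -/
def PartIndex.label {f : MonicIrred K →₀ IntPartition} (x : PartIndex f) : MonicIrred K × ℕ+ :=
  (x.1, x.2.1)

/-- The summands of `ClassModule f` with a given prime power. -/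
def PartIndex.fiberEquiv (f : MonicIrred K →₀ IntPartition) (c : MonicIrred K × ℕ+) :
    {x : PartIndex f // x.label = c} ≃ Fin ((f c.1).count c.2) where
  toFun x := Fin.cast (by obtain ⟨⟨φ, k, i⟩, rfl⟩ := x; rfl) x.1.2.2
  invFun i := ⟨⟨c.1, ⟨c.2, i⟩⟩, rfl⟩
  left_inv := by
    rintro ⟨⟨φ, k, i⟩, rfl⟩
    rfl
  right_inv i := rfl

instance (f : MonicIrred K →₀ IntPartition) (c : MonicIrred K × ℕ+) :
    Finite {x : PartIndex f // x.label = c} :=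
  Finite.of_equiv _ (PartIndex.fiberEquiv f c).symm

theorem PartIndex.card_fiber (f : MonicIrred K →₀ IntPartition) (c : MonicIrred K × ℕ+) :
    Nat.card {x : PartIndex f // x.label = c} = (f c.1).count c.2 := by
  rw [Nat.card_congr (PartIndex.fiberEquiv f c), Nat.card_fin]

instance (f : MonicIrred K →₀ IntPartition) : Finite (PartIndex f) := by
  classical
  have : Finite (Σ φ : f.support, (f φ.1).ToType) := inferInstance
  refine Finite.of_surjective
    (fun x : Σ φ : f.support, (f φ.1).ToType => (⟨x.1.1, x.2⟩ : PartIndex f)) ?_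
  rintro ⟨φ, k, i⟩
  refine ⟨⟨⟨φ, ?_⟩, ⟨k, i⟩⟩, rfl⟩
  rw [Finsupp.mem_support_iff]
  intro h
  have := i.2
  simp [h] at this

/-- The module `⨁_φ ⨁_j K[X] / (φ ^ λ_{φ,j})`, as a product over all its cyclic summands. -/
abbrev PartModule (f : MonicIrred K →₀ IntPartition) : Type _ :=
  ∀ x : PartIndex f, PrimePowerModule x.label

theorem nonempty_classModule_equiv_partModule (f : MonicIrred K →₀ IntPartition) :
    Nonempty (ClassModule f ≃ₗ[K[X]] PartModule f) := by
  classical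
  have := Fintype.ofFinite (PartIndex f)
  exact ⟨(DirectSum.sigmaLcurryEquiv K[X]
    (δ := fun (φ : MonicIrred K) (j : (f φ).ToType) => PrimePowerModule (φ, j.1))).symm.trans
    (DirectSum.linearEquivFunOnFintype K[X] (PartIndex f)
      (fun x => PrimePowerModule x.label))⟩

/-- Only the multiplicity of each label `(φ, k)` matters, so later decompositions of `PartModule`
reduce to counting labels. -/
theorem nonempty_partModule_equiv_pi {ι : Type*} [Finite ι] (f : MonicIrred K →₀ IntPartition)
    (l : ι → MonicIrred K × ℕ+) (h : ∀ c, Nat.card {i // l i = c} = (f c.1).count c.2) :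
    Nonempty (PartModule f ≃ₗ[K[X]] ∀ i, PrimePowerModule (l i)) := by
  obtain ⟨e, he⟩ := exists_equiv_comp_eq l (PartIndex.label (f := f))
    fun c => (h c).trans (PartIndex.card_fiber f c).symm
  obtain rfl : l = fun i => (e i).label := funext fun i => (he i).symm
  exact ⟨(LinearEquiv.piCongrLeft K[X] (fun x : PartIndex f => PrimePowerModule x.label) e).symm⟩

theorem nonempty_partModule_add_equiv (f g : MonicIrred K →₀ IntPartition) :
    Nonempty (PartModule (f + g) ≃ₗ[K[X]] PartModule f × PartModule g) := by
  obtain ⟨e⟩ := nonempty_partModule_equiv_pi (f + g)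
    (Sum.elim (PartIndex.label (f := f)) (PartIndex.label (f := g))) fun c => by
      rw [Nat.card_congr Equiv.subtypeSum, Nat.card_sum]
      simp only [Sum.elim_inl, Sum.elim_inr, PartIndex.card_fiber]
      simp
  exact ⟨e.trans ((LinearEquiv.sumPiEquivProdPi K[X] _ _
    (fun i => PrimePowerModule (Sum.elim (PartIndex.label (f := f)) (PartIndex.label (f := g)) i))))⟩

theorem nonempty_partModule_single_equiv (φ : MonicIrred K) (k : ℕ+) :
    Nonempty (PartModule (Finsupp.single φ {k}) ≃ₗ[K[X]] PrimePowerModule (φ, k)) := by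
  classical
  obtain ⟨e⟩ := nonempty_partModule_equiv_pi (Finsupp.single φ {k})
    (fun _ : Unit => (φ, k)) fun c => by
      by_cases h : (φ, k) = c
      · subst h
        simp
      · have : IsEmpty {i : Unit // (φ, k) = c} := ⟨fun x => h x.2⟩
        rw [Nat.card_of_isEmpty]
        rcases c with ⟨ψ, j⟩
        by_cases h' : φ = ψ
        · subst h'
          have : j ≠ k := fun hjk => h (by rw [hjk])
          simp [this]
        · simp [h']
  exact ⟨e.trans (LinearEquiv.funUnique Unit K[X] (PrimePowerModule (φ, k)))⟩

theorem subsingleton_partModule_zero :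
    Subsingleton (PartModule (0 : MonicIrred K →₀ IntPartition)) := by
  obtain ⟨e⟩ := nonempty_partModule_equiv_pi (0 : MonicIrred K →₀ IntPartition)
    (fun i : Empty => i.elim) fun c => by simp
  exact e.toEquiv.subsingleton

/-- Every finitely generated torsion `K[X]`-module is some `PartModule f`. -/
theorem exists_nonempty_equiv_partModule {M : Type*} [AddCommGroup M] [Module K[X] M]
    [Module.Finite K[X] M] (hM : Module.IsTorsion K[X] M) :
    ∃ f : MonicIrred K →₀ IntPartition, Nonempty (M ≃ₗ[K[X]] PartModule f) := by
  classical
  obtain ⟨ι, _, p, hp, e, ⟨E⟩⟩ := Module.equiv_directSum_of_isTorsion hM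
  -- The structure theorem allows exponent zero and non-monic primes: the former give trivial
  -- factors, which are dropped, and the latter are normalized, which keeps the ideals.
  let l : {i // e i ≠ 0} → MonicIrred K × ℕ+ := fun i =>
    (⟨normalize (p i.1), Polynomial.monic_normalize (hp i.1).ne_zero,
      (normalize_associated (p i.1)).symm.irreducible (hp i.1)⟩, ⟨e i.1, Nat.pos_of_ne_zero i.2⟩)
  let f : MonicIrred K →₀ IntPartition := ∑ i, Finsupp.single (l i).1 {(l i).2}
  obtain ⟨e₂⟩ := nonempty_partModule_equiv_pi f l fun c => by
    rw [Finsupp.finsetSum_apply, Multiset.count_sum', Nat.card_eq_fintype_card,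
      Fintype.card_subtype, Finset.card_filter]
    refine Finset.sum_congr rfl fun i _ => ?_
    rcases c with ⟨ψ, j⟩
    by_cases h1 : (l i).1 = ψ
    · by_cases h2 : (l i).2 = j
      · rw [if_pos (Prod.ext h1 h2)]
        simp [h1, h2]
      · rw [if_neg fun h => h2 (by rw [h])]
        simp [h1, Ne.symm h2]
    · rw [if_neg fun h => h1 (by rw [h])]
      simp [h1]
  have hs : ∀ i : {i // ¬ e i ≠ 0}, Subsingleton (K[X] ⧸ Submodule.span K[X] {p i.1 ^ e i.1}) := by
    rintro ⟨i, hi⟩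
    rw [not_not] at hi
    rw [Submodule.Quotient.subsingleton_iff, hi, pow_zero]
    exact Ideal.span_singleton_one
  let E₁ : (∀ i : ι, K[X] ⧸ Submodule.span K[X] {p i ^ e i}) ≃ₗ[K[X]]
      ∀ i : {i // e i ≠ 0}, K[X] ⧸ Submodule.span K[X] {p i.1 ^ e i.1} :=
    LinearEquiv.ofBijective (LinearMap.pi fun i => LinearMap.proj i.1) (by
      refine ⟨fun x y hxy => funext fun i => ?_, fun g => ?_⟩
      · by_cases h : e i ≠ 0
        · exact congrFun hxy ⟨i, h⟩
        · exact (hs ⟨i, h⟩).elim _ _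
      · refine ⟨fun i => if h : e i ≠ 0 then g ⟨i, h⟩ else 0, funext fun i => ?_⟩
        exact dif_pos i.2)
  exact ⟨f, ⟨E.trans ((DirectSum.linearEquivFunOnFintype K[X] ι _).trans (E₁.trans
    ((LinearEquiv.piCongrRight fun i => Submodule.quotEquivOfEq _ _ (by
      exact Ideal.span_singleton_eq_span_singleton.2
        ((normalize_associated (p i.1)).symm.pow_pow))).trans e₂.symm)))⟩⟩

end ClassModule
end GLDoubleCosets
end

/-! ### Orders of torsion submodules, and uniqueness of the decomposition -/

noncomputable section
namespace GLDoubleCosets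

section Torsion

variable {R M N : Type*} [CommRing R] [AddCommGroup M] [Module R M] [AddCommGroup N] [Module R N]

theorem card_torsionBy_congr (e : M ≃ₗ[R] N) (a : R) :
    Nat.card (Submodule.torsionBy R M a) = Nat.card (Submodule.torsionBy R N a) :=
  Nat.card_congr (e.toEquiv.subtypeEquiv fun x => by
    simp only [Submodule.mem_torsionBy_iff]
    change _ ↔ a • e x = 0
    rw [← map_smul, LinearEquiv.map_eq_zero_iff])

theorem card_torsionBy_prod (a : R) :
    Nat.card (Submodule.torsionBy R (M × N) a) =
      Nat.card (Submodule.torsionBy R M a) * Nat.card (Submodule.torsionBy R N a) := by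
  rw [← Nat.card_prod]
  exact Nat.card_congr
    { toFun := fun x => (⟨x.1.1, congrArg Prod.fst x.2⟩, ⟨x.1.2, congrArg Prod.snd x.2⟩)
      invFun := fun x => ⟨(x.1.1, x.2.1), Prod.ext x.1.2 x.2.2⟩
      left_inv := fun _ => rfl
      right_inv := fun _ => rfl }

/-- For `M` finite and `A` contained in the image of multiplication by `a`, the number of `x` with
`a • x ∈ A`. -/
theorem card_comap_smul [Finite M] (a : R) (A : Submodule R M)
    (hA : ∀ x ∈ A, ∃ y, a • y = x) :
    Nat.card {x : M // a • x ∈ A} = Nat.card (Submodule.torsionBy R M a) * Nat.card A := by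
  let ψ : (A.comap (LinearMap.lsmul R M a)) →ₗ[R] A :=
    (LinearMap.lsmul R M a).restrict fun x hx => hx
  have hψ : Function.Surjective ψ := fun x => by
    obtain ⟨y, hy⟩ := hA x.1 x.2
    exact ⟨⟨y, by simp [hy]⟩, Subtype.ext hy⟩
  have h1 := Submodule.card_eq_card_quotient_mul_card (LinearMap.ker ψ)
  rw [Nat.card_congr (ψ.quotKerEquivOfSurjective hψ).toEquiv] at h1
  change Nat.card (A.comap (LinearMap.lsmul R M a)) = _
  rw [h1]
  congr 1
  exact Nat.card_congr
    { toFun := fun x => ⟨x.1.1, congrArg Subtype.val x.2⟩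
      invFun := fun x => ⟨⟨x.1, by
        have : a • x.1 = 0 := x.2
        simp [this]⟩, Subtype.ext x.2⟩
      left_inv := fun _ => rfl
      right_inv := fun _ => rfl }

end Torsion

variable {K : Type*} [Field K]

theorem MonicIrred.natDegree_pos (φ : MonicIrred K) : 0 < φ.1.natDegree :=
  φ.2.2.natDegree_pos

theorem MonicIrred.isCoprime {φ ψ : MonicIrred K} (h : φ ≠ ψ) : IsCoprime φ.1 ψ.1 :=
  (φ.2.2.isCoprime_or_dvd ψ.1) |>.resolve_right fun hd => h <| Subtype.ext <|
    Polynomial.eq_of_monic_of_associated φ.2.1 ψ.2.1 (φ.2.2.associated_of_dvd ψ.2.2 hd)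

theorem finite_quotient_of_monic [Finite K] {a : K[X]} (ha : a.Monic) :
    Finite (K[X] ⧸ Ideal.span {a}) := by
  have := Polynomial.Monic.finite_quotient ha
  exact Module.finite_of_finite K

theorem card_quotient_of_monic [Finite K] {a : K[X]} (ha : a.Monic) :
    Nat.card (K[X] ⧸ Ideal.span {a}) = Nat.card K ^ a.natDegree := by
  have := Polynomial.Monic.finite_quotient ha
  rw [Module.natCard_eq_pow_finrank (K := K), finrank_quotient_span_eq_natDegree]

instance [Finite K] (x : MonicIrred K × ℕ+) : Finite (PrimePowerModule x) :=
  finite_quotient_of_monic (x.1.2.1.pow _)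

theorem card_primePowerModule [Finite K] (x : MonicIrred K × ℕ+) :
    Nat.card (PrimePowerModule x) = Nat.card K ^ (x.1.1.natDegree * x.2) := by
  rw [card_quotient_of_monic (x.1.2.1.pow _), x.1.2.1.natDegree_pow, mul_comm]

theorem smul_mk_eq_zero_iff {R : Type*} [CommRing R] (a b y : R) :
    b • Ideal.Quotient.mk (Ideal.span {a}) y = 0 ↔ a ∣ b * y := by
  change Ideal.Quotient.mk (Ideal.span {a}) (b * y) = 0 ↔ _
  rw [Ideal.Quotient.eq_zero_iff_mem, Ideal.mem_span_singleton]

theorem card_torsionBy_primePowerModule_self [Finite K] (φ : MonicIrred K) (e : ℕ+) (k : ℕ) :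
    Nat.card (Submodule.torsionBy K[X] (PrimePowerModule (φ, e)) (φ.1 ^ k)) =
      Nat.card K ^ (φ.1.natDegree * min (e : ℕ) k) := by
  rcases le_total (e : ℕ) k with h | h
  · rw [min_eq_left h, ← card_primePowerModule (φ, e)]
    refine Nat.card_congr (Equiv.subtypeUnivEquiv fun x => ?_)
    rw [Submodule.mem_torsionBy_iff]
    obtain ⟨y, rfl⟩ := Ideal.Quotient.mk_surjective x
    exact (smul_mk_eq_zero_iff _ _ _).2 (dvd_mul_of_dvd_left (pow_dvd_pow _ h) _)
  · rw [min_eq_right h]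
    obtain ⟨d, hd⟩ := Nat.exists_eq_add_of_le h
    have hφ : φ.1 ≠ 0 := φ.2.2.ne_zero
    -- With `d = e - k`, the `φ^k`-torsion is generated by the class of `φ^d`, whose annihilator is
    -- `(φ^k)`; so it is a copy of `K[X]/(φ^k)`.
    let T : K[X] →ₗ[K[X]] Submodule.torsionBy K[X] (PrimePowerModule (φ, e)) (φ.1 ^ k) :=
      LinearMap.codRestrict _ (LinearMap.toSpanSingleton K[X] (PrimePowerModule (φ, e))
        (Ideal.Quotient.mk _ (φ.1 ^ d))) fun y => by
          rw [Submodule.mem_torsionBy_iff]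
          refine (smul_mk_eq_zero_iff _ _ _).2 ⟨y, ?_⟩
          change φ.1 ^ k * (y * φ.1 ^ d) = φ.1 ^ (e : ℕ) * y
          rw [hd]
          ring
    have hT : Function.Surjective T := by
      rintro ⟨x, hx⟩
      obtain ⟨y, rfl⟩ := Ideal.Quotient.mk_surjective x
      obtain ⟨z, hz⟩ := (smul_mk_eq_zero_iff _ _ _).1 hx
      refine ⟨z, Subtype.ext ?_⟩
      change Ideal.Quotient.mk _ (z * φ.1 ^ d) = _
      congr 1
      refine mul_left_cancel₀ (pow_ne_zero k hφ) (.trans ?_ hz.symm)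
      change _ = φ.1 ^ (e : ℕ) * z
      rw [hd]
      ring
    have hker : LinearMap.ker T = Ideal.span {φ.1 ^ k} := by
      ext y
      rw [LinearMap.mem_ker, Ideal.mem_span_singleton, ← Subtype.coe_inj]
      change Ideal.Quotient.mk _ (y * φ.1 ^ d) = 0 ↔ _
      rw [Ideal.Quotient.eq_zero_iff_mem, Ideal.mem_span_singleton]
      change φ.1 ^ (e : ℕ) ∣ _ ↔ _
      rw [hd, pow_add, mul_dvd_mul_iff_right (pow_ne_zero d hφ)]
    rw [← Nat.card_congr ((Submodule.quotEquivOfEq _ _ hker).symm.trans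
      (T.quotKerEquivOfSurjective hT)).toEquiv, card_quotient_of_monic (φ.2.1.pow _),
      φ.2.1.natDegree_pow, mul_comm]

theorem smul_eq_zero_of_coprime {φ ψ : MonicIrred K} (h : φ ≠ ψ) (e : ℕ+) (k : ℕ)
    {x : PrimePowerModule (ψ, e)} (hx : φ.1 ^ k • x = 0) : x = 0 := by
  obtain ⟨y, rfl⟩ := Ideal.Quotient.mk_surjective x
  have h1 : ψ.1 ^ (e : ℕ) ∣ _ := (smul_mk_eq_zero_iff _ _ _).1 hx
  exact Ideal.Quotient.eq_zero_iff_mem.2 (Ideal.mem_span_singleton.2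
    ((MonicIrred.isCoprime h).symm.pow.dvd_of_dvd_mul_left h1))

/-- Torsion orders multiply over summands, and summands at primes other than `φ` have no `φ`-power
torsion. -/
theorem card_torsionBy_partModule [Finite K] (f : MonicIrred K →₀ IntPartition)
    (φ : MonicIrred K) (k : ℕ) :
    Nat.card (Submodule.torsionBy K[X] (PartModule f) (φ.1 ^ k)) =
      Nat.card K ^ (φ.1.natDegree * (f φ).dk k) := by
  classical
  induction f using finsupp_multiset_induction with
  | h0 =>
    have := subsingleton_partModule_zero (K := K)
    rw [Nat.card_unique]
    simp [IntPartition.dk_eq]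
  | hs f ψ j _ ih =>
    obtain ⟨e₁⟩ := nonempty_partModule_add_equiv f (Finsupp.single ψ {j})
    obtain ⟨e₂⟩ := nonempty_partModule_single_equiv ψ j
    rw [card_torsionBy_congr e₁, card_torsionBy_prod, ih, card_torsionBy_congr e₂,
      Finsupp.add_apply, IntPartition.dk_add, mul_add, pow_add]
    congr 1
    by_cases h : φ = ψ
    · subst h
      rw [card_torsionBy_primePowerModule_self, Finsupp.single_eq_same, IntPartition.dk_singleton]
    · have : Subsingleton (Submodule.torsionBy K[X] (PrimePowerModule (ψ, j)) (φ.1 ^ k)) :=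
        ⟨fun x y => Subtype.ext ((smul_eq_zero_of_coprime h j k x.2).trans
          (smul_eq_zero_of_coprime h j k y.2).symm)⟩
      rw [Nat.card_unique, Finsupp.single_eq_of_ne h]
      simp [IntPartition.dk_eq]

theorem partModule_equiv_unique [Finite K] {f g : MonicIrred K →₀ IntPartition}
    (e : PartModule f ≃ₗ[K[X]] PartModule g) : f = g := by
  ext1 φ
  refine IntPartition.ext_dk fun k => ?_
  have h := card_torsionBy_congr e (φ.1 ^ k)
  rw [card_torsionBy_partModule, card_torsionBy_partModule] at h
  exact Nat.eq_of_mul_eq_mul_left φ.natDegree_pos (Nat.pow_right_injective Finite.one_lt_card h)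

theorem card_partModule [Finite K] (f : MonicIrred K →₀ IntPartition) :
    Nat.card (PartModule f) = Nat.card K ^ f.sum fun φ p => φ.1.natDegree * p.size := by
  classical
  induction f using finsupp_multiset_induction with
  | h0 =>
    have := subsingleton_partModule_zero (K := K)
    rw [Nat.card_unique]
    simp
  | hs f ψ j _ ih =>
    obtain ⟨e₁⟩ := nonempty_partModule_add_equiv f (Finsupp.single ψ {j})
    obtain ⟨e₂⟩ := nonempty_partModule_single_equiv ψ j
    rw [Nat.card_congr e₁.toEquiv, Nat.card_prod, ih, Nat.card_congr e₂.toEquiv,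
      card_primePowerModule, Finsupp.sum_add_index', Finsupp.sum_single_index, pow_add]
    · simp [IntPartition.size]
    · simp [IntPartition.size]
    · simp [IntPartition.size]
    · simp [IntPartition.size, mul_add]

end GLDoubleCosets
end

/-! ### Counting injective homomorphisms and automorphisms -/

noncomputable section
namespace GLDoubleCosets

section Injective

variable {R M N N' : Type*} [CommRing R] [AddCommGroup M] [Module R M] [AddCommGroup N] [Module R N]
  [AddCommGroup N'] [Module R N']

/-- Injective linear maps. -/
abbrev InjHom (R N M : Type*) [CommRing R] [AddCommGroup M] [Module R M] [AddCommGroup N]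
    [Module R N] : Type _ :=
  {u : N →ₗ[R] M // Function.Injective u}

theorem card_injHom_congr (e : N ≃ₗ[R] N') :
    Nat.card (InjHom R N M) = Nat.card (InjHom R N' M) :=
  Nat.card_congr
    { toFun := fun u => ⟨u.1 ∘ₗ e.symm.toLinearMap, u.2.comp e.symm.injective⟩
      invFun := fun u => ⟨u.1 ∘ₗ e.toLinearMap, u.2.comp e.injective⟩
      left_inv := fun u => by ext; simp
      right_inv := fun u => by ext; simp }

/-- Linear maps out of `R / (a)` are given by the image of `1`. -/
def quotientSpanHomEquiv (R M : Type*) [CommRing R] [AddCommGroup M] [Module R M] (a : R) :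
    ((R ⧸ Ideal.span {a}) →ₗ[R] M) ≃ {y : M // a • y = 0} where
  toFun g := ⟨g (Ideal.Quotient.mk _ 1), by
    rw [← map_smul, (smul_mk_eq_zero_iff a a 1).2 (by simp), map_zero]⟩
  invFun y := Submodule.liftQ _ (LinearMap.toSpanSingleton R M y.1) <| by
    refine (Ideal.span_singleton_le_iff_mem _).2 ?_
    rw [LinearMap.mem_ker, LinearMap.toSpanSingleton_apply, y.2]
  left_inv g := by
    refine Submodule.linearMap_qext _ (LinearMap.ext_ring ?_)
    simp
  right_inv y := Subtype.ext (one_smul R y.1)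

theorem quotientSpanHomEquiv_symm_mk (a : R) (y : {y : M // a • y = 0}) (r : R) :
    (quotientSpanHomEquiv R M a).symm y (Ideal.Quotient.mk _ r) = r • y.1 := rfl

/-- If `p^k • y = 0` and `p^(k-1) • y = f n`, then `p • n = 0` by injectivity. So the excluded `y`
are those with `p^(k-1) • y` in the image of the `p`-torsion of `N`. By `hN` that image consists of
multiples of `p^(k-1)`, so each of its elements has a full coset of the `p^(k-1)`-torsion of `M` as
preimage. -/
theorem card_smul_notMem_range [Finite M] {p : R} (k : ℕ+)
    (hN : ∀ x : N, p • x = 0 → ∃ y, p ^ (k - 1 : ℕ) • y = x) (f : InjHom R N M) :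
    (Nat.card {y : {y : M // p ^ (k : ℕ) • y = 0} // p ^ (k - 1 : ℕ) • y.1 ∉ LinearMap.range f.1} : ℚ)
      = Nat.card (Submodule.torsionBy R M (p ^ (k : ℕ))) -
        Nat.card (Submodule.torsionBy R M (p ^ (k - 1 : ℕ))) *
          Nat.card (Submodule.torsionBy R N p) := by
  classical
  have hk : (k : ℕ) = (k - 1 : ℕ) + 1 := (Nat.sub_add_cancel k.pos).symm
  have hpk : p ^ (k : ℕ) = p * p ^ (k - 1 : ℕ) := by rw [← pow_succ', ← hk]
  let A : Submodule R M := (Submodule.torsionBy R N p).map f.1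
  have hA : Nat.card A = Nat.card (Submodule.torsionBy R N p) :=
    (Nat.card_congr (Submodule.equivMapOfInjective f.1 f.2 _).toEquiv).symm
  have h1 := card_comap_smul (M := M) (p ^ (k - 1 : ℕ)) A <| by
    rintro _ ⟨n, hn, rfl⟩
    obtain ⟨n', rfl⟩ := hN n hn
    exact ⟨f.1 n', (map_smul _ _ _).symm⟩
  have h2 := Nat.card_congr (Equiv.sumCompl (fun y : {y : M // p ^ (k : ℕ) • y = 0} =>
    p ^ (k - 1 : ℕ) • y.1 ∈ LinearMap.range f.1))
  rw [Nat.card_sum] at h2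
  have h3 : Nat.card {y : {y : M // p ^ (k : ℕ) • y = 0} //
      p ^ (k - 1 : ℕ) • y.1 ∈ LinearMap.range f.1} =
      Nat.card {y : M // p ^ (k - 1 : ℕ) • y ∈ A} := by
    refine Nat.card_congr ((Equiv.subtypeSubtypeEquivSubtypeInter
      (fun y : M => p ^ (k : ℕ) • y = 0) (fun y => p ^ (k - 1 : ℕ) • y ∈ LinearMap.range f.1)).trans
      (Equiv.subtypeEquivRight fun y => ⟨?_, ?_⟩))
    · rintro ⟨hy, n, hn⟩
      refine ⟨n, f.2 ?_, hn⟩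
      change f.1 (p • n) = f.1 0
      rw [map_smul, hn, smul_smul, ← hpk, hy, map_zero]
    · rintro ⟨n, hn, hny⟩
      refine ⟨?_, n, hny⟩
      have hn' : p • n = 0 := hn
      rw [hpk, mul_smul, ← hny, ← map_smul, hn', map_zero]
  rw [h3, h1, hA] at h2
  rw [eq_sub_iff_add_eq']
  exact_mod_cast h2

variable [IsDomain R] [IsPrincipalIdealRing R]

/-- The scalars carrying `y` into the range of `f` form an ideal containing `p^k`, hence generated
by some `p^i` with `i ≤ k`. Excluding `p^(k-1)` forces `i = k`, so the cyclic summand embeds and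
meets the range of `f` trivially. -/
theorem injective_coprod_iff {p : R} (hp : Irreducible p) (k : ℕ+) (f : N →ₗ[R] M)
    (y : {y : M // p ^ (k : ℕ) • y = 0}) :
    Function.Injective (f.coprod ((quotientSpanHomEquiv R M _).symm y)) ↔
      Function.Injective f ∧ p ^ (k - 1 : ℕ) • y.1 ∉ LinearMap.range f := by
  have hk : (k : ℕ) = (k - 1 : ℕ) + 1 := (Nat.sub_add_cancel k.pos).symm
  constructor
  · intro h
    refine ⟨fun x x' hx => congrArg Prod.fst (h (a₁ := (x, 0)) (a₂ := (x', 0)) (by simpa using hx)),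
      ?_⟩
    rintro ⟨x, hx⟩
    have h0 : f.coprod ((quotientSpanHomEquiv R M _).symm y)
        (x, - Ideal.Quotient.mk _ (p ^ (k - 1 : ℕ))) = 0 := by
      rw [LinearMap.coprod_apply, map_neg, quotientSpanHomEquiv_symm_mk, hx, add_neg_cancel]
    have h1 := congrArg Prod.snd ((injective_iff_map_eq_zero _).1 h _ h0)
    simp only [Prod.snd_zero, neg_eq_zero] at h1
    rw [Ideal.Quotient.eq_zero_iff_mem, Ideal.mem_span_singleton,
      pow_dvd_pow_iff hp.ne_zero hp.not_isUnit] at h1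
    omega
  · rintro ⟨hf, hy⟩
    rw [injective_iff_map_eq_zero]
    rintro ⟨x, z⟩ hxz
    obtain ⟨r, rfl⟩ := Ideal.Quotient.mk_surjective z
    rw [LinearMap.coprod_apply, quotientSpanHomEquiv_symm_mk] at hxz
    let I : Ideal R := (LinearMap.range f).comap (LinearMap.toSpanSingleton R M y.1)
    have hI : ∀ s, s ∈ I ↔ s • y.1 ∈ LinearMap.range f := fun s => Iff.rfl
    obtain ⟨d, hd⟩ := (IsPrincipalIdealRing.principal I).principal
    have hdvd : ∀ s, s • y.1 ∈ LinearMap.range f ↔ d ∣ s := fun s => by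
      rw [← hI, hd]
      exact Ideal.mem_span_singleton
    obtain ⟨i, hi, hdi⟩ := (dvd_prime_pow hp.prime k).1
      ((hdvd (p ^ (k : ℕ))).1 (by rw [y.2]; exact zero_mem _))
    rw [hdvd, hdi.dvd_iff_dvd_left, pow_dvd_pow_iff hp.ne_zero hp.not_isUnit] at hy
    have hr : p ^ (k : ℕ) ∣ r := by
      have : i = k := by omega
      rw [← this, ← hdi.dvd_iff_dvd_left, ← hdvd]
      exact ⟨-x, by rw [map_neg, neg_eq_iff_add_eq_zero, hxz]⟩
    have hz : Ideal.Quotient.mk (Ideal.span {p ^ (k : ℕ)}) r = 0 :=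
      Ideal.Quotient.eq_zero_iff_mem.2 (Ideal.mem_span_singleton.2 hr)
    obtain ⟨s, rfl⟩ := hr
    rw [mul_comm, mul_smul, y.2, smul_zero, add_zero] at hxz
    rw [hz, (injective_iff_map_eq_zero f).1 hf x hxz]
    rfl

/-- An injection on the product is an injection `f` on `N` with an admissible image `y` of the new
generator, and the number of such `y` is the same for every `f`. -/
theorem card_injHom_prod [Finite M] [Finite N] {p : R} (hp : Irreducible p) (k : ℕ+)
    (hN : ∀ x : N, p • x = 0 → ∃ y, p ^ (k - 1 : ℕ) • y = x) :
    (Nat.card (InjHom R (N × (R ⧸ Ideal.span {p ^ (k : ℕ)})) M) : ℚ) =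
      Nat.card (InjHom R N M) * (Nat.card (Submodule.torsionBy R M (p ^ (k : ℕ))) -
        Nat.card (Submodule.torsionBy R M (p ^ (k - 1 : ℕ))) *
          Nat.card (Submodule.torsionBy R N p)) := by
  let e : InjHom R (N × (R ⧸ Ideal.span {p ^ (k : ℕ)})) M ≃ Σ f : InjHom R N M,
      {y : {y : M // p ^ (k : ℕ) • y = 0} // p ^ (k - 1 : ℕ) • y.1 ∉ LinearMap.range f.1} :=
    { toFun := fun u =>
        have h := (injective_coprod_iff hp k (u.1 ∘ₗ LinearMap.inl R _ _)
          (quotientSpanHomEquiv R M _ (u.1 ∘ₗ LinearMap.inr R _ _))).1 (by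
            rw [Equiv.symm_apply_apply, ← LinearMap.comp_coprod, LinearMap.coprod_inl_inr]
            exact u.2)
        ⟨⟨_, h.1⟩, ⟨_, h.2⟩⟩
      invFun := fun x => ⟨_, (injective_coprod_iff hp k x.1.1 x.2.1).2 ⟨x.1.2, x.2.2⟩⟩
      left_inv := fun u => by
        refine Subtype.ext ?_
        simp only [Equiv.symm_apply_apply]
        rw [← LinearMap.comp_coprod, LinearMap.coprod_inl_inr]
        rfl
      right_inv := by
        rintro ⟨⟨f, hf⟩, ⟨y, hy⟩⟩
        exact Sigma.subtype_ext (Subtype.ext (by simp)) (by simp) }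
  have : Finite (N →ₗ[R] M) := DFunLike.finite _
  have := Fintype.ofFinite (InjHom R N M)
  have : ∀ f : InjHom R N M, Finite {y : {y : M // p ^ (k : ℕ) • y = 0} //
    p ^ (k - 1 : ℕ) • y.1 ∉ LinearMap.range f.1} := fun f => inferInstance
  rw [Nat.card_congr e, Nat.card_sigma, Nat.cast_sum,
    Finset.sum_congr rfl fun f _ => card_smul_notMem_range k hN f, Finset.sum_const,
    nsmul_eq_mul, Finset.card_univ, ← Nat.card_eq_fintype_card]

end Injective

section Automorphisms

variable {K : Type*} [Field K]

/-- This supplies the divisibility hypothesis of `card_injHom_prod`: the `φ`-torsion of `K[X]/(φ^j)`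
is generated by `φ^(j-1)`, a multiple of `φ^(k-1)` when `k ≤ j`, and other primes contribute no
`φ`-torsion. -/
theorem exists_smul_eq_of_smul_eq_zero (f : MonicIrred K →₀ IntPartition) (φ : MonicIrred K)
    (k : ℕ+) (hk : ∀ j ∈ f φ, k ≤ j) (x : PartModule f) (hx : φ.1 • x = 0) :
    ∃ y, φ.1 ^ (k - 1 : ℕ) • y = x := by
  have h : ∀ i, ∃ z, φ.1 ^ (k - 1 : ℕ) • z = x i := by
    rintro ⟨ψ, j, i⟩
    have hxi := congrFun hx ⟨ψ, j, i⟩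
    rw [Pi.smul_apply, Pi.zero_apply] at hxi
    by_cases h : φ = ψ
    · subst h
      have hj : k ≤ j := hk j (Multiset.count_pos.1 (Nat.zero_le _ |>.trans_lt i.2))
      obtain ⟨a, ha⟩ := Ideal.Quotient.mk_surjective (x ⟨φ, j, i⟩)
      rw [← ha] at hxi ⊢
      have h1 : φ.1 ^ (j : ℕ) ∣ _ := (smul_mk_eq_zero_iff _ _ _).1 hxi
      have hj' : (j : ℕ) = (j - k : ℕ) + (k - 1 : ℕ) + 1 := by
        have : (k : ℕ) ≤ j := hj
        have := k.pos
        omega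
      rw [hj', pow_succ', mul_dvd_mul_iff_left φ.2.2.ne_zero] at h1
      obtain ⟨b, rfl⟩ := h1
      -- Here `a = φ^(j-1) * b`, and `φ^(k-1)` is split off.
      refine ⟨Ideal.Quotient.mk _ (φ.1 ^ (j - k : ℕ) * b), ?_⟩
      change Ideal.Quotient.mk _ (φ.1 ^ (k - 1 : ℕ) * _) = _
      congr 1
      ring
    · refine ⟨0, ?_⟩
      rw [smul_zero]
      refine (smul_eq_zero_of_coprime h j 1 ?_).symm
      rw [pow_one]
      exact hxi
  choose y hy using h
  exact ⟨y, funext hy⟩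

/-- The target `M` is kept separate from `f` so that it stays fixed while the source grows; `S` and
`B` likewise fix the ranges of the products. -/
theorem card_injHom_partModule [Finite K] {M : Type*} [AddCommGroup M] [Module K[X] M] [Finite M]
    (S : Finset (MonicIrred K)) (B : MonicIrred K → ℕ) (f : MonicIrred K →₀ IntPartition)
    (hS : ∀ φ ∉ S, f φ = 0) (hB : ∀ φ, ∀ j ∈ f φ, (j : ℕ) ≤ B φ) :
    (Nat.card (InjHom K[X] (PartModule f) M) : ℚ) =
      ∏ φ ∈ S, IntPartition.partProd (fun k i =>
        (Nat.card (Submodule.torsionBy K[X] M (φ.1 ^ k)) : ℚ) -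
          Nat.card (Submodule.torsionBy K[X] M (φ.1 ^ (k - 1))) *
            ((Nat.card K : ℚ) ^ φ.1.natDegree) ^ i) (B φ) (f φ) := by
  classical
  induction f using finsupp_multiset_induction with
  | h0 =>
    have := subsingleton_partModule_zero (K := K)
    refine Eq.trans ?_ (Finset.prod_eq_one fun φ _ => IntPartition.partProd_zero _ _).symm
    have : Unique (InjHom K[X] (PartModule (0 : MonicIrred K →₀ IntPartition)) M) :=
      { default := ⟨0, fun x y _ => Subsingleton.elim _ _⟩
        uniq := fun u => Subtype.ext (LinearMap.ext fun x => by
          rw [Subsingleton.elim x 0, map_zero, map_zero]) }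
    rw [Nat.card_unique, Nat.cast_one]
  | hs f ψ k hk ih =>
    obtain ⟨e₁⟩ := nonempty_partModule_add_equiv f (Finsupp.single ψ {k})
    obtain ⟨e₂⟩ := nonempty_partModule_single_equiv ψ k
    have hfS : ∀ φ ∉ S, f φ = 0 := fun φ hφ => by
      have := hS φ hφ
      rw [Finsupp.add_apply, add_eq_zero] at this
      exact this.1
    have hψ : ψ ∈ S := by
      by_contra h
      have := hS ψ h
      simp at this
    rw [card_injHom_congr (e₁.trans ((LinearEquiv.refl _ _).prodCongr e₂)),
      card_injHom_prod ψ.2.2 k (exists_smul_eq_of_smul_eq_zero f ψ k hk),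
      ih hfS fun φ j hj => hB φ j (by simp [hj]),
      ← Finset.mul_prod_erase S _ hψ, ← Finset.mul_prod_erase S _ hψ, Finsupp.add_apply,
      Finsupp.single_eq_same, add_comm (f ψ), Multiset.singleton_add,
      IntPartition.partProd_cons _ _ _ _ hk (hB ψ k (by simp)), mul_right_comm]
    congr 1
    · congr 2
      -- The `ψ`-torsion of the source has order `q^(deg ψ)` to the number of parts already placed,
      -- since `d_1` is the number of parts.
      have := card_torsionBy_partModule f ψ 1
      rw [pow_one] at this
      rw [this, IntPartition.dk_one]
      push_cast
      rw [pow_mul]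
    · refine Finset.prod_congr rfl fun φ hφ => ?_
      rw [Finsupp.add_apply, Finsupp.single_eq_of_ne (Finset.ne_of_mem_erase hφ), add_zero]

/-- Since `d_k - d_(k-1) = m_k + numGt k`, the factor of index `i` in `cd` is the one of index `m_k
- i` here; the product is reversed. -/
theorem cd_eq_partProd (q d : ℕ) (p : IntPartition) :
    cd q d p = IntPartition.partProd (fun k i =>
      (q : ℚ) ^ (d * p.dk k) - (q : ℚ) ^ (d * p.dk (k - 1)) * ((q : ℚ) ^ d) ^ i) p.size p := by
  refine Finset.prod_congr rfl fun k hk => ?_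
  obtain ⟨m, rfl⟩ : ∃ m, k = m + 1 := ⟨k - 1, by have := (Finset.mem_Icc.1 hk).1; omega⟩
  have hI : Finset.Icc 1 (p.mult (m + 1)) = Finset.Ico (0 + 1) (p.mult (m + 1) + 1) := by
    ext
    simp only [Finset.mem_Icc, Finset.mem_Ico]
    omega
  rw [← Finset.prod_range_reflect, Finset.range_eq_Ico, hI, ← Finset.prod_Ico_add']
  refine Finset.prod_congr rfl fun i hi => ?_
  have := (Finset.mem_Ico.1 hi).2
  have h1 := p.dk_succ m
  have h2 := p.numGt_eq m
  dsimp only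
  rw [← pow_mul, ← pow_add, ← mul_add, mul_comm d, mul_comm d]
  congr 3
  rw [Nat.add_sub_cancel]
  omega

/-- Injective endomorphisms of a finite module are automorphisms, so this is the centralizer order.
-/
theorem card_injHom_partModule_self [Finite K] (f : MonicIrred K →₀ IntPartition) :
    (Nat.card (InjHom K[X] (PartModule f) (PartModule f)) : ℚ) =
      f.prod fun φ p => cd (Nat.card K) φ.1.natDegree p := by
  rw [card_injHom_partModule f.support (fun φ => (f φ).size) f
    (fun φ hφ => Finsupp.notMem_support_iff.1 hφ) fun φ j hj => IntPartition.le_size hj]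
  refine Finset.prod_congr rfl fun φ _ => ?_
  simp only [card_torsionBy_partModule, cd_eq_partProd, Nat.cast_pow]

end Automorphisms

end GLDoubleCosets
end

/-! ### From matrices to modules: conjugacy, realization, block matrices -/

noncomputable section
namespace GLDoubleCosets

theorem card_injHom_congr_right {R M M' N : Type*} [CommRing R] [AddCommGroup M] [Module R M]
    [AddCommGroup M'] [Module R M'] [AddCommGroup N] [Module R N] (e : M ≃ₗ[R] M') :
    Nat.card (InjHom R N M) = Nat.card (InjHom R N M') :=
  Nat.card_congr
    { toFun := fun u => ⟨e.toLinearMap ∘ₗ u.1, e.injective.comp u.2⟩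
      invFun := fun u => ⟨e.symm.toLinearMap ∘ₗ u.1, e.symm.injective.comp u.2⟩
      left_inv := fun u => by ext; simp
      right_inv := fun u => by ext; simp }

variable {K : Type*} [Field K] {n : ℕ}

/-- The `K[X]`-module `K^n` on which `X` acts as the matrix `A`. -/
abbrev MatrixModule (A : Matrix (Fin n) (Fin n) K) : Type _ := Module.AEval' (Matrix.toLin' A)

theorem isClassMap_iff (A : Matrix (Fin n) (Fin n) K) (f : MonicIrred K →₀ IntPartition) :
    IsClassMap A f ↔ Nonempty (MatrixModule A ≃ₗ[K[X]] PartModule f) := by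
  obtain ⟨e⟩ := nonempty_classModule_equiv_partModule f
  exact ⟨fun ⟨u⟩ => ⟨u.trans e⟩, fun ⟨u⟩ => ⟨u.trans e.symm⟩⟩

theorem nonempty_matrixModule_equiv (A : Matrix (Fin n) (Fin n) K) :
    Nonempty (MatrixModule A ≃ₗ[K[X]] PartModule (classMap A)) := by
  rw [← isClassMap_iff]
  refine Classical.epsilon_spec (p := IsClassMap A) ?_
  have h : Module.IsTorsion K[X] (MatrixModule A) :=
    Module.AEval.isTorsion_of_finiteDimensional K _ _
  obtain ⟨f, hf⟩ := exists_nonempty_equiv_partModule h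
  exact ⟨f, (isClassMap_iff A f).2 hf⟩

theorem classMap_eq_of_equiv [Finite K] {A : Matrix (Fin n) (Fin n) K}
    {f : MonicIrred K →₀ IntPartition} (e : MatrixModule A ≃ₗ[K[X]] PartModule f) :
    classMap A = f := by
  obtain ⟨u⟩ := nonempty_matrixModule_equiv A
  exact partModule_equiv_unique (u.symm.trans e)

/-- The homomorphism between matrix modules given by an intertwining matrix. -/
def intertwinerHom (A B : Matrix (Fin n) (Fin n) K)
    (c : {c : GL (Fin n) K // (c : Matrix (Fin n) (Fin n) K) * A = B * c}) :
    InjHom K[X] (MatrixModule A) (MatrixModule B) :=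
  ⟨LinearMap.ofAEval _ ((Module.AEval'.of (Matrix.toLin' B)).toLinearMap ∘ₗ
    Matrix.toLin' (c.1 : Matrix (Fin n) (Fin n) K)) fun v => by
      change Module.AEval'.of (Matrix.toLin' B) (Matrix.toLin' c.1.1 (Matrix.toLin' A v)) =
        Polynomial.X • Module.AEval'.of (Matrix.toLin' B) (Matrix.toLin' c.1.1 v)
      rw [Module.AEval'.X_smul_of, ← LinearMap.comp_apply, ← LinearMap.comp_apply,
        ← Matrix.toLin'_mul, ← Matrix.toLin'_mul, c.2], by
    intro v w hvw
    exact Matrix.mulVec_injective_iff_isUnit.2 c.1.isUnit hvw⟩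

/-- A `K[X]`-linear map is a `K`-linear map commuting with the action of `X`, and a square matrix is
injective exactly when it is invertible. -/
theorem bijective_intertwinerHom (A B : Matrix (Fin n) (Fin n) K) :
    Function.Bijective (intertwinerHom A B) := by
  constructor
  · intro c c' h
    refine Subtype.ext (Units.ext (Matrix.toLin'.injective (LinearMap.ext fun v => ?_)))
    exact LinearMap.congr_fun (congrArg Subtype.val h) (Module.AEval'.of (Matrix.toLin' A) v)
  · intro u
    let L : (Fin n → K) →ₗ[K] (Fin n → K) := (Module.AEval'.of (Matrix.toLin' B)).symm.toLinearMap ∘ₗ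
      u.1.restrictScalars K ∘ₗ (Module.AEval'.of (Matrix.toLin' A)).toLinearMap
    let c := LinearMap.toMatrix' L
    have hcL : Matrix.toLin' c = L := Matrix.toLin'_toMatrix' L
    have hc : IsUnit c := by
      rw [← Matrix.mulVec_injective_iff_isUnit]
      intro v w hvw
      rw [← Matrix.toLin'_apply, ← Matrix.toLin'_apply, hcL] at hvw
      exact u.2 hvw
    have hcA : c * A = B * c := by
      refine Matrix.toLin'.injective (LinearMap.ext fun v => ?_)
      rw [Matrix.toLin'_mul, Matrix.toLin'_mul, hcL]
      have h := map_smul u.1 (Polynomial.X : K[X]) (Module.AEval'.of (Matrix.toLin' A) v)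
      rw [Module.AEval'.X_smul_of] at h
      have h2 := congrArg (Module.AEval'.of (Matrix.toLin' B)).symm h
      rw [Module.AEval'.of_symm_X_smul] at h2
      exact h2
    refine ⟨⟨hc.unit, hcA⟩, Subtype.ext (LinearMap.ext fun v => ?_)⟩
    exact LinearMap.congr_fun hcL v

theorem card_intertwiners (A B : Matrix (Fin n) (Fin n) K) :
    Nat.card {c : GL (Fin n) K // (c : Matrix (Fin n) (Fin n) K) * A = B * c} =
      Nat.card (InjHom K[X] (MatrixModule A) (MatrixModule B)) :=
  Nat.card_congr (Equiv.ofBijective _ (bijective_intertwinerHom A B))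

theorem isConj_iff_classMap_eq [Finite K] (g h : GL (Fin n) K) :
    IsConj g h ↔ classMap (g : Matrix (Fin n) (Fin n) K) = classMap (h : Matrix (Fin n) (Fin n) K) := by
  obtain ⟨eg⟩ := nonempty_matrixModule_equiv (g : Matrix (Fin n) (Fin n) K)
  obtain ⟨eh⟩ := nonempty_matrixModule_equiv (h : Matrix (Fin n) (Fin n) K)
  rw [isConj_iff]
  constructor
  · rintro ⟨c, hc⟩
    have hc' : (c : Matrix (Fin n) (Fin n) K) * g = h * c := by
      rw [mul_inv_eq_iff_eq_mul] at hc
      exact congrArg Units.val hc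
    let u := intertwinerHom _ _ ⟨c, hc'⟩
    have hu : Function.Bijective u.1 := ⟨u.2, fun w => by
      obtain ⟨w, rfl⟩ := (Module.AEval'.of _).surjective w
      refine ⟨(Matrix.toLin' ((c⁻¹ : GL (Fin n) K) : Matrix (Fin n) (Fin n) K) w), ?_⟩
      change Matrix.toLin' (c : Matrix (Fin n) (Fin n) K) (Matrix.toLin' _ w) = w
      rw [← LinearMap.comp_apply, ← Matrix.toLin'_mul, ← Units.val_mul, mul_inv_cancel,
        Units.val_one, Matrix.toLin'_one]
      rfl⟩
    exact classMap_eq_of_equiv ((LinearEquiv.ofBijective u.1 hu).trans eh)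
  · intro hgh
    rw [hgh] at eg
    let u := eg.trans eh.symm
    obtain ⟨c, -⟩ := (bijective_intertwinerHom (g : Matrix (Fin n) (Fin n) K) h).2
      ⟨u.toLinearMap, u.injective⟩
    exact ⟨c.1, by rw [mul_inv_eq_iff_eq_mul]; exact Units.ext c.2⟩

/-- Both modules are isomorphic to one `PartModule`, so conjugators from `g` to `h` correspond to
its injective endomorphisms. -/
theorem card_conjugators [Finite K] {g h : GL (Fin n) K}
    (hgh : classMap (g : Matrix (Fin n) (Fin n) K) = classMap (h : Matrix (Fin n) (Fin n) K)) :
    (Nat.card {c : GL (Fin n) K // c * g = h * c} : ℚ) =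
      (classMap (g : Matrix (Fin n) (Fin n) K)).prod fun φ p => cd (Nat.card K) φ.1.natDegree p := by
  obtain ⟨e⟩ := nonempty_matrixModule_equiv (g : Matrix (Fin n) (Fin n) K)
  obtain ⟨e'⟩ := nonempty_matrixModule_equiv (h : Matrix (Fin n) (Fin n) K)
  rw [← hgh] at e'
  rw [← card_injHom_partModule_self, ← card_injHom_congr e, ← card_injHom_congr_right e',
    ← card_intertwiners]
  congr 1
  exact Nat.card_congr (Equiv.subtypeEquivRight fun c => Units.ext_iff)

theorem size_classMap [Finite K] (A : Matrix (Fin n) (Fin n) K) :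
    ((classMap A).sum fun φ p => φ.1.natDegree * p.size) = n := by
  obtain ⟨e⟩ := nonempty_matrixModule_equiv A
  have h1 := card_partModule (classMap A)
  rw [← Nat.card_congr e.toEquiv, ← Nat.card_congr (Module.AEval'.of (Matrix.toLin' A)).toEquiv,
    Nat.card_fun, Nat.card_fin] at h1
  exact (Nat.pow_right_injective Finite.one_lt_card h1).symm

/-- The polynomial `X`. -/
def MonicIrred.X (K : Type*) [Field K] : MonicIrred K :=
  ⟨Polynomial.X, Polynomial.monic_X, Polynomial.irreducible_X⟩

theorem card_torsionBy_X [Finite K] (f : MonicIrred K →₀ IntPartition) :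
    Nat.card (Submodule.torsionBy K[X] (PartModule f) Polynomial.X) =
      Nat.card K ^ Multiset.card (f (MonicIrred.X K)) := by
  have h := card_torsionBy_partModule f (MonicIrred.X K) 1
  rw [pow_one, IntPartition.dk_one] at h
  refine h.trans ?_
  simp [MonicIrred.X]

/-- Invertibility of `g` means there is no `X`-torsion, whose order is `q` to the number of parts at
`X`. -/
theorem classMap_X [Finite K] (g : GL (Fin n) K) :
    classMap (g : Matrix (Fin n) (Fin n) K) (MonicIrred.X K) = 0 := by
  obtain ⟨e⟩ := nonempty_matrixModule_equiv (g : Matrix (Fin n) (Fin n) K)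
  have h := card_torsionBy_X (classMap (g : Matrix (Fin n) (Fin n) K))
  rw [← card_torsionBy_congr e] at h
  have : Subsingleton (Submodule.torsionBy K[X] (MatrixModule (g : Matrix (Fin n) (Fin n) K))
      Polynomial.X) := by
    have hx : ∀ x : Submodule.torsionBy K[X] (MatrixModule (g : Matrix (Fin n) (Fin n) K))
        Polynomial.X, Matrix.toLin' (g : Matrix (Fin n) (Fin n) K)
          ((Module.AEval'.of _).symm x.1) = 0 := fun x => by
      rw [← Module.AEval'.of_symm_X_smul]
      exact congrArg (Module.AEval'.of _).symm x.2
    exact ⟨fun x y => Subtype.ext ((Module.AEval'.of _).symm.injective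
      (Matrix.mulVec_injective_iff_isUnit.2 g.isUnit ((hx x).trans (hx y).symm)))⟩
  rw [Nat.card_unique] at h
  rw [← Multiset.card_eq_zero]
  by_contra h0
  exact (Nat.one_lt_pow h0 (Finite.one_lt_card (α := K))).ne h

/-- `PartModule f` has `K`-dimension `n`; multiplication by `X`, transported to `K^n`, is invertible
because `f` has no part at `X`. -/
theorem exists_classMap_eq [Finite K] (f : MonicIrred K →₀ IntPartition)
    (hX : f (MonicIrred.X K) = 0) (hn : (f.sum fun φ p => φ.1.natDegree * p.size) = n) :
    ∃ g : GL (Fin n) K, classMap (g : Matrix (Fin n) (Fin n) K) = f := by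
  have hcard := card_partModule f
  have : Module.Finite K (PartModule f) := Module.Finite.of_finite
  rw [hn, Module.natCard_eq_pow_finrank (K := K)] at hcard
  have hrank := Nat.pow_right_injective (Finite.one_lt_card (α := K)) hcard
  let e : (Fin n → K) ≃ₗ[K] PartModule f := LinearEquiv.ofFinrankEq _ _ (by
    rw [hrank, Module.finrank_fin_fun])
  let mulX : PartModule f →ₗ[K] PartModule f :=
    (LinearMap.lsmul K[X] (PartModule f) Polynomial.X).restrictScalars K
  let L : (Fin n → K) →ₗ[K] (Fin n → K) := e.symm.toLinearMap ∘ₗ mulX ∘ₗ e.toLinearMap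
  let A := LinearMap.toMatrix' L
  have hAL : Matrix.toLin' A = L := Matrix.toLin'_toMatrix' L
  have htor := card_torsionBy_X f
  rw [hX, Multiset.card_zero, pow_zero, Nat.card_eq_one_iff_unique] at htor
  have hA : IsUnit A := by
    rw [← Matrix.mulVec_injective_iff_isUnit]
    intro v w hvw
    rw [← Matrix.toLin'_apply, ← Matrix.toLin'_apply, hAL] at hvw
    have h1 : (Polynomial.X : K[X]) • e v = (Polynomial.X : K[X]) • e w := e.symm.injective hvw
    have h2 := htor.1.elim ⟨e v - e w, by
      rw [Submodule.mem_torsionBy_iff, smul_sub, sub_eq_zero]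
      exact h1⟩ ⟨0, zero_mem _⟩
    exact e.injective (sub_eq_zero.1 (congrArg Subtype.val h2))
  refine ⟨hA.unit, classMap_eq_of_equiv (A := A) (LinearEquiv.ofAEval _ e fun v => ?_)⟩
  change e (Matrix.toLin' A v) = _
  rw [hAL]
  exact e.apply_symm_apply _

theorem nonempty_partModule_sum_equiv {ι : Type*} [Fintype ι]
    (f : ι → MonicIrred K →₀ IntPartition) :
    Nonempty (PartModule (∑ i, f i) ≃ₗ[K[X]] ∀ i, PartModule (f i)) := by
  obtain ⟨e⟩ := nonempty_partModule_equiv_pi (∑ i, f i)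
    (fun x : Σ i, PartIndex (f i) => x.2.label) fun c => by
      have E : {x : Σ i, PartIndex (f i) // x.2.label = c} ≃
          Σ i, {x : PartIndex (f i) // x.label = c} :=
        { toFun := fun x => ⟨x.1.1, ⟨x.1.2, x.2⟩⟩
          invFun := fun x => ⟨⟨x.1, x.2.1⟩, x.2.2⟩
          left_inv := fun _ => rfl
          right_inv := fun _ => rfl }
      rw [Nat.card_congr E, Nat.card_sigma, Finsupp.finsetSum_apply, Multiset.count_sum']
      simp only [PartIndex.card_fiber]
  exact ⟨e.trans (LinearEquiv.piCurry K[X] fun i (x : PartIndex (f i)) =>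
    PrimePowerModule x.label)⟩

/-- The module of a block-diagonal matrix is the product of the modules of its blocks; `E` below
splits the coordinates accordingly. -/
theorem classMap_blockEmbedding [Finite K] (c : Composition n)
    (h : (i : Fin c.length) → GL (Fin (c.blocksFun i)) K) :
    classMap (blockEmbedding K c h : Matrix (Fin n) (Fin n) K) =
      ∑ i, classMap (h i : Matrix (Fin (c.blocksFun i)) (Fin (c.blocksFun i)) K) := by
  obtain ⟨e⟩ := nonempty_partModule_sum_equiv fun i =>
    classMap (h i : Matrix (Fin (c.blocksFun i)) (Fin (c.blocksFun i)) K)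
  have e₁ := fun i =>
    (nonempty_matrixModule_equiv (h i : Matrix (Fin (c.blocksFun i)) (Fin (c.blocksFun i)) K)).some
  let E : (Fin n → K) ≃ₗ[K] ∀ i,
      MatrixModule (h i : Matrix (Fin (c.blocksFun i)) (Fin (c.blocksFun i)) K) :=
    (LinearEquiv.funCongrLeft K K c.blocksFinEquiv).trans
      ((LinearEquiv.piCurry K fun (i : Fin c.length) (_ : Fin (c.blocksFun i)) => K).trans
        (LinearEquiv.piCongrRight fun i => Module.AEval'.of _))
  have hE : ∀ v i, E v i = Module.AEval'.of _ fun j => v (c.blocksFinEquiv ⟨i, j⟩) := fun v i => rfl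
  refine classMap_eq_of_equiv ((LinearEquiv.ofAEval _ E fun v => ?_).trans
    ((LinearEquiv.piCongrRight e₁).trans e.symm))
  funext i
  rw [Pi.smul_apply, hE, hE, Module.AEval'.X_smul_of]
  congr 1
  funext j
  change ∑ y, Matrix.blockDiagonal' (fun i => (h i).1)
    (c.blocksFinEquiv.symm (c.blocksFinEquiv ⟨i, j⟩)) (c.blocksFinEquiv.symm y) * v y =
    ∑ y, (h i).1 j y * v (c.blocksFinEquiv ⟨i, y⟩)
  rw [Equiv.symm_apply_apply, ← c.blocksFinEquiv.sum_comp, Fintype.sum_sigma]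
  rw [Finset.sum_eq_single i]
  · simp [Matrix.blockDiagonal'_apply_eq]
  · intro b _ hb
    refine Finset.sum_eq_zero fun y _ => ?_
    rw [Equiv.symm_apply_apply, Matrix.blockDiagonal'_apply_ne _ _ _ hb.symm, zero_mul]
  · simp

end GLDoubleCosets
end

/-! ### Counting maps of a given type -/

noncomputable section
namespace GLDoubleCosets

section Functions

variable {A P : Type*} [Finite A] [DecidableEq P]

/-- The value `z` is the default (later the empty partition). Its fibre is not prescribed, but
finiteness of `A` determines its size. -/
theorem card_fiber_add_card (z : P) {s : Multiset P} (hz : z ∉ s) {u : A → P}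
    (h : ∀ p, p ≠ z → Nat.card {a // u a = p} = s.count p) :
    Nat.card {a // u a = z} + Multiset.card s = Nat.card A := by
  classical
  have := Fintype.ofFinite A
  have h1 : ∀ a ∈ (Finset.univ : Finset A), u a ∈ insert z s.toFinset := fun a _ => by
    by_cases ha : u a = z
    · simp [ha]
    · have : 0 < Nat.card {b // u b = u a} := by
        have : Nonempty {b // u b = u a} := ⟨⟨a, rfl⟩⟩
        exact Nat.card_pos
      rw [h _ ha, Multiset.count_pos] at this
      simp [this]
  have h2 := Finset.card_eq_sum_card_fiberwise h1
  rw [Finset.sum_insert (by simpa using hz)] at h2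
  rw [Nat.card_eq_fintype_card (α := A), ← Finset.card_univ, h2, Nat.card_eq_fintype_card,
    Fintype.card_subtype]
  congr 1
  rw [← Multiset.toFinset_sum_count_eq s]
  refine Finset.sum_congr rfl fun p hp => ?_
  have hpz : p ≠ z := fun h => hz (by simpa [h] using hp)
  rw [← h p hpz, Nat.card_eq_fintype_card, Fintype.card_subtype]

theorem card_fiber_eq (z : P) {s : Multiset P} (hz : z ∉ s) {u v : A → P}
    (hu : ∀ p, p ≠ z → Nat.card {a // u a = p} = s.count p)
    (hv : ∀ p, p ≠ z → Nat.card {a // v a = p} = s.count p) (p : P) :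
    Nat.card {a // u a = p} = Nat.card {a // v a = p} := by
  by_cases hp : p = z
  · subst hp
    have := card_fiber_add_card p hz hu
    have := card_fiber_add_card p hz hv
    omega
  · rw [hu p hp, hv p hp]

/-- The number of functions whose values other than `z` form a given multiset. -/
theorem card_functions (z : P) {s : Multiset P} (hz : z ∉ s) {u : A → P}
    (hu : ∀ p, p ≠ z → Nat.card {a // u a = p} = s.count p) :
    (Nat.card {v : A → P // ∀ p, p ≠ z → Nat.card {a // v a = p} = s.count p} : ℚ) =
      (((Nat.card A).choose (Multiset.card s) : ℚ) * (((Multiset.card s).factorial : ℚ) /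
        ∏ p ∈ s.toFinset, ((s.count p).factorial : ℚ))) := by
  classical
  have := Fintype.ofFinite A
  set S := {v : A → P // ∀ p, p ≠ z → Nat.card {a // v a = p} = s.count p}
  have hcard := card_fiber_add_card z hz hu
  -- The count is by orbit and stabilizer for `Perm A`. The stabilizer of `u` is the product of the
  -- symmetric groups of its fibres, the fibre over `z` having `|A| - |s|` elements.
  have hstab : Nat.card {g : Equiv.Perm A // u ∘ g = u} =
      (∏ p ∈ s.toFinset, (s.count p).factorial) * (Nat.card A - Multiset.card s).factorial := by
    rw [Nat.card_eq_fintype_card, DomMulAct.stabilizer_card' u]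
    have hsub : Finset.univ.image u ⊆ insert z s.toFinset := by
      intro p hp
      obtain ⟨a, -, rfl⟩ := Finset.mem_image.1 hp
      by_cases ha : u a = z
      · simp [ha]
      · have : 0 < Nat.card {b // u b = u a} := by
          have : Nonempty {b // u b = u a} := ⟨⟨a, rfl⟩⟩
          exact Nat.card_pos
        rw [hu _ ha, Multiset.count_pos] at this
        simp [this]
    rw [Finset.prod_subset hsub fun p _ hp => ?_, Finset.prod_insert (by simpa using hz), mul_comm]
    · congr 1
      · refine Finset.prod_congr rfl fun p hp => ?_
        have hpz : p ≠ z := fun h => hz (by simpa [h] using hp)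
        rw [← hu p hpz, Nat.card_eq_fintype_card]
      · rw [← Nat.card_eq_fintype_card]
        congr 1
        omega
    · have : IsEmpty {a // u a = p} := ⟨fun a => hp (Finset.mem_image.2 ⟨a.1, Finset.mem_univ _, a.2⟩)⟩
      rw [Fintype.card_eq_zero, Nat.factorial_zero]
  -- Transitivity: functions with equal fibre sizes differ by a permutation.
  have hperm : ∀ v : S, ∃ g : Equiv.Perm A, ∀ a, u (g a) = v.1 a := fun v =>
    exists_equiv_comp_eq v.1 u (card_fiber_eq z hz v.2 hu)
  have hmem : ∀ g : Equiv.Perm A, ∀ p, p ≠ z → Nat.card {a // (u ∘ g) a = p} = s.count p :=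
    fun g p hp => (Nat.card_congr (g.subtypeEquiv fun _ => Iff.rfl)).trans (hu p hp)
  choose σ hσ using hperm
  have E : Equiv.Perm A ≃ S × {g : Equiv.Perm A // u ∘ g = u} :=
    { toFun := fun g => (⟨u ∘ g, hmem g⟩, ⟨g * (σ ⟨u ∘ g, hmem g⟩)⁻¹, by
        funext a
        have := hσ ⟨u ∘ g, hmem g⟩ ((σ ⟨u ∘ g, hmem g⟩)⁻¹ a)
        exact this.symm.trans (congrArg u ((σ ⟨u ∘ g, hmem g⟩).apply_symm_apply a))⟩)
      invFun := fun x => x.2.1 * σ x.1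
      left_inv := fun g => by simp
      right_inv := fun x => by
        obtain ⟨v, g, hg⟩ := x
        have hv : (⟨u ∘ (g * σ v : Equiv.Perm A), hmem _⟩ : S) = v := Subtype.ext <| by
          funext a
          exact (congrFun hg (σ v a)).trans (hσ v a)
        refine Prod.ext hv (Subtype.ext ?_)
        simp only
        rw [hv, mul_inv_cancel_right] }
  have hE := Nat.card_congr E
  rw [Nat.card_prod, hstab, Nat.card_eq_fintype_card, Fintype.card_perm,
    ← Nat.card_eq_fintype_card] at hE
  have hle : Multiset.card s ≤ Nat.card A := by omega
  rw [← Nat.choose_mul_factorial_mul_factorial hle, mul_assoc, ← mul_assoc (Nat.card S)] at hE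
  have hE' := Nat.eq_of_mul_eq_mul_right (Nat.factorial_pos _) ((mul_assoc _ _ _).trans hE)
  have hne : (∏ p ∈ s.toFinset, ((s.count p).factorial : ℚ)) ≠ 0 :=
    Finset.prod_ne_zero_iff.2 fun p _ => by exact_mod_cast (Nat.factorial_pos _).ne'
  rw [← mul_div_assoc, eq_div_iff hne]
  exact_mod_cast hE'.symm

end Functions

section Types

variable {K : Type*} [Field K]

instance finite_natDegree_eq [Finite K] (d : ℕ) : Finite {φ : MonicIrred K // φ.1.natDegree = d} := by
  refine Finite.of_injective (β := Fin (d + 1) → K) (fun φ i => φ.1.1.coeff i) ?_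
  intro φ ψ h
  refine Subtype.ext (Subtype.ext (Polynomial.ext fun i => ?_))
  by_cases hi : i < d + 1
  · exact congrFun h ⟨i, hi⟩
  · rw [Polynomial.coeff_eq_zero_of_natDegree_lt (by rw [φ.2]; omega),
      Polynomial.coeff_eq_zero_of_natDegree_lt (by rw [ψ.2]; omega)]

theorem count_typeOfMap (f : MonicIrred K →₀ IntPartition) (d : ℕ) {p : IntPartition} (hp : p ≠ 0) :
    (typeOfMap f d).count p = Nat.card {φ : MonicIrred K // φ.1.natDegree = d ∧ f φ = p} := by
  classical
  rw [typeOfMap, Multiset.count_map, ← Finset.filter_val, Finset.card_val, Finset.filter_filter,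
    ← Nat.card_eq_finsetCard]
  refine Nat.card_congr (Equiv.subtypeEquivRight fun φ => ?_)
  simp only [Finset.mem_filter, Finsupp.mem_support_iff]
  constructor
  · rintro ⟨-, h1, h2⟩
    exact ⟨h1, h2.symm⟩
  · rintro ⟨h1, rfl⟩
    exact ⟨hp, h1, rfl⟩

theorem zero_notMem_typeOfMap (f : MonicIrred K →₀ IntPartition) (d : ℕ) : 0 ∉ typeOfMap f d := by
  simp only [typeOfMap, Multiset.mem_map, Finset.mem_val, Finset.mem_filter, Finsupp.mem_support_iff]
  rintro ⟨φ, ⟨h, -⟩, h'⟩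
  exact h h'

theorem typeOfMap_eq_iff (f : MonicIrred K →₀ IntPartition) (t : ClassType) (ht : ∀ d, 0 ∉ t d) :
    typeOfMap f = t ↔ ∀ d p, p ≠ 0 →
      Nat.card {φ : MonicIrred K // φ.1.natDegree = d ∧ f φ = p} = (t d).count p := by
  constructor
  · rintro rfl d p hp
    rw [count_typeOfMap f d hp]
  · intro h
    funext d
    ext p
    by_cases hp : p = 0
    · subst hp
      rw [Multiset.count_eq_zero_of_notMem (zero_notMem_typeOfMap f d),
        Multiset.count_eq_zero_of_notMem (ht d)]
    · rw [count_typeOfMap f d hp, h d p hp]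

theorem prod_eq_prod_typeOfMap {A : Type*} [CommMonoid A] (G : ℕ → IntPartition → A)
    (f : MonicIrred K →₀ IntPartition) (D : Finset ℕ) (hD : ∀ φ ∈ f.support, φ.1.natDegree ∈ D) :
    (f.prod fun φ p => G φ.1.natDegree p) = ∏ d ∈ D, ((typeOfMap f d).map (G d)).prod := by
  rw [Finsupp.prod, ← Finset.prod_fiberwise_of_maps_to hD]
  refine Finset.prod_congr rfl fun d _ => ?_
  rw [typeOfMap, Multiset.map_map]
  refine Finset.prod_congr rfl fun φ hφ => ?_
  rw [(Finset.mem_filter.1 hφ).2]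
  rfl

theorem prod_eq_of_typeOfMap_eq {A : Type*} [CommMonoid A] (G : ℕ → IntPartition → A)
    {f f' : MonicIrred K →₀ IntPartition} (h : typeOfMap f = typeOfMap f') :
    (f.prod fun φ p => G φ.1.natDegree p) = f'.prod fun φ p => G φ.1.natDegree p := by
  classical
  rw [prod_eq_prod_typeOfMap G f ((f.support ∪ f'.support).image fun φ => φ.1.natDegree)
      fun φ hφ => Finset.mem_image_of_mem _ (Finset.mem_union_left _ hφ),
    prod_eq_prod_typeOfMap G f' ((f.support ∪ f'.support).image fun φ => φ.1.natDegree)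
      fun φ hφ => Finset.mem_image_of_mem _ (Finset.mem_union_right _ hφ), h]

theorem sum_eq_of_typeOfMap_eq {f f' : MonicIrred K →₀ IntPartition}
    (h : typeOfMap f = typeOfMap f') :
    (f.sum fun φ p => φ.1.natDegree * p.size) = f'.sum fun φ p => φ.1.natDegree * p.size :=
  -- The sum is read as a product in `Multiplicative ℕ`.
  prod_eq_of_typeOfMap_eq (A := Multiplicative ℕ) (fun d p => Multiplicative.ofAdd (d * p.size)) h

theorem natDegree_mem_Icc {n : ℕ} {f : MonicIrred K →₀ IntPartition}
    (hn : (f.sum fun φ p => φ.1.natDegree * p.size) = n) {φ : MonicIrred K} (hφ : φ ∈ f.support) :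
    φ.1.natDegree ∈ Finset.Icc 1 n := by
  refine Finset.mem_Icc.2 ⟨φ.natDegree_pos, ?_⟩
  have h1 : φ.1.natDegree * (f φ).size ≤ n := by
    rw [← hn]
    exact Finset.single_le_sum (f := fun φ => φ.1.natDegree * (f φ).size)
      (fun _ _ => Nat.zero_le _) hφ
  refine le_trans (Nat.le_mul_of_pos_right _ ?_) h1
  obtain ⟨j, hj⟩ := Multiset.exists_mem_of_ne_zero (Finsupp.mem_support_iff.1 hφ)
  exact lt_of_lt_of_le j.pos (IntPartition.le_size hj)

/-- The monic irreducible polynomials of degree `d` other than `X`. -/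
abbrev IrredOfDegree (K : Type*) [Field K] (d : ℕ) : Type _ :=
  {φ : MonicIrred K // φ.1.natDegree = d ∧ φ ≠ MonicIrred.X K}

instance [Finite K] (d : ℕ) : Finite (IrredOfDegree K d) :=
  Finite.of_injective (β := {φ : MonicIrred K // φ.1.natDegree = d}) (fun φ => ⟨φ.1, φ.2.1⟩)
    fun _ _ h => Subtype.ext (congrArg (fun x => x.1) h)

theorem card_irredOfDegree (d : ℕ) : Nat.card (IrredOfDegree K d) = numIrred K d :=
  Nat.card_congr
    { toFun := fun φ => ⟨φ.1.1, φ.1.2.1, φ.1.2.2, φ.2.1, fun h => φ.2.2 (Subtype.ext h)⟩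
      invFun := fun φ => ⟨⟨φ.1, φ.2.1, φ.2.2.1⟩, φ.2.2.2.1, fun h => φ.2.2.2.2 (congrArg Subtype.val h)⟩
      left_inv := fun _ => rfl
      right_inv := fun _ => rfl }

theorem card_irredOfDegree_fiber {f : MonicIrred K → IntPartition} (hX : f (MonicIrred.X K) = 0)
    (d : ℕ) {p : IntPartition} (hp : p ≠ 0) :
    Nat.card {a : IrredOfDegree K d // f a.1 = p} =
      Nat.card {φ : MonicIrred K // φ.1.natDegree = d ∧ f φ = p} :=
  Nat.card_congr
    { toFun := fun a => ⟨a.1.1, a.1.2.1, a.2⟩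
      invFun := fun φ => ⟨⟨φ.1, φ.2.1, fun h => hp (by rw [← φ.2.2, h, hX])⟩, φ.2.2⟩
      left_inv := fun _ => rfl
      right_inv := fun _ => rfl }

/-- Maps of the same type differ by a degree-preserving permutation of the polynomials. -/
theorem exists_perm_of_typeOfMap_eq [Finite K] {f f' : MonicIrred K →₀ IntPartition}
    (hX : f (MonicIrred.X K) = 0) (hX' : f' (MonicIrred.X K) = 0)
    (h : typeOfMap f = typeOfMap f') :
    ∃ σ : Equiv.Perm (MonicIrred K), (∀ φ, (σ φ).1.natDegree = φ.1.natDegree) ∧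
      σ (MonicIrred.X K) = MonicIrred.X K ∧ ∀ φ, f (σ φ) = f' φ := by
  classical
  have hfin : ∀ (g : MonicIrred K → IntPartition) (c : ℕ × Prop × IntPartition),
      Finite {φ : MonicIrred K // (φ.1.natDegree, φ = MonicIrred.X K, g φ) = c} := fun g c =>
    Finite.of_injective (β := {φ : MonicIrred K // φ.1.natDegree = c.1})
      (fun φ => ⟨φ.1, congrArg Prod.fst φ.2⟩) fun _ _ h => Subtype.ext (congrArg (fun x => x.1) h)
  have := hfin f
  have := hfin f'
  -- Matching degree, the truth value of `φ = X` and the partition all at once makes `σ` preserve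
  -- degrees, fix `X` and carry `f'` to `f`.
  obtain ⟨σ, hσ⟩ := exists_equiv_comp_eq
    (fun φ : MonicIrred K => (φ.1.natDegree, φ = MonicIrred.X K, f' φ))
    (fun φ : MonicIrred K => (φ.1.natDegree, φ = MonicIrred.X K, f φ)) (by
      rintro ⟨d, b, p⟩
      by_cases hb : b
      · refine Nat.card_congr (Equiv.subtypeEquivRight fun φ => ?_)
        simp only [Prod.mk.injEq, hb, eq_iff_iff, iff_true]
        refine and_congr_right fun _ => and_congr_right fun hφ => ?_
        rw [hφ, hX, hX']
      · have key : ∀ g : MonicIrred K → IntPartition,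
            Nat.card {φ : MonicIrred K // (φ.1.natDegree, φ = MonicIrred.X K, g φ) = (d, b, p)} =
              Nat.card {a : IrredOfDegree K d // g a.1 = p} := fun g => by
          refine Nat.card_congr ((Equiv.subtypeEquivRight fun φ => ?_).trans
            (Equiv.subtypeSubtypeEquivSubtypeInter (fun φ : MonicIrred K =>
              φ.1.natDegree = d ∧ φ ≠ MonicIrred.X K) (fun φ => g φ = p)).symm)
          simp only [Prod.mk.injEq, hb, eq_iff_iff, iff_false, and_assoc, ne_eq]
        rw [key, key]
        -- The type does not record empty partitions; their number agrees because there are finitely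
        -- many polynomials of degree `d`.
        refine card_fiber_eq 0 (zero_notMem_typeOfMap f d) (fun p hp => ?_) (fun p hp => ?_) p
        · rw [card_irredOfDegree_fiber hX' d hp, h, count_typeOfMap f' d hp]
        · rw [card_irredOfDegree_fiber hX d hp, count_typeOfMap f d hp])
  simp only [Prod.mk.injEq, eq_iff_iff] at hσ
  exact ⟨σ, fun φ => (hσ φ).1, (hσ _).2.1.2 rfl, fun φ => (hσ φ).2.2⟩

theorem typeOfMap_equivMapDomain (σ : Equiv.Perm (MonicIrred K))
    (hσ : ∀ φ, (σ φ).1.natDegree = φ.1.natDegree) (f : MonicIrred K →₀ IntPartition) :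
    typeOfMap (f.equivMapDomain σ) = typeOfMap f := by
  rw [typeOfMap_eq_iff _ _ (zero_notMem_typeOfMap f)]
  intro d p hp
  rw [count_typeOfMap f d hp]
  refine Nat.card_congr (σ.symm.subtypeEquiv fun φ => ?_)
  rw [Finsupp.equivMapDomain_apply, ← hσ (σ.symm φ), Equiv.apply_symm_apply]

/-- Such a map amounts to independent functions on the irreducibles other than `X` of each degree `1
≤ d ≤ n`, each counted by `card_functions`. The total size `n` forces it to vanish in larger
degrees. -/
theorem card_maps_of_type [Finite K] (n : ℕ) (f : MonicIrred K →₀ IntPartition)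
    (hX : f (MonicIrred.X K) = 0) (hn : (f.sum fun φ p => φ.1.natDegree * p.size) = n) :
    (Nat.card {f' : MonicIrred K →₀ IntPartition // f' (MonicIrred.X K) = 0 ∧
      typeOfMap f' = typeOfMap f} : ℚ) = numClasses K n (typeOfMap f) := by
  classical
  let V : ℕ → Type _ := fun d => {v : IrredOfDegree K d → IntPartition //
    ∀ p, p ≠ 0 → Nat.card {a // v a = p} = (typeOfMap f d).count p}
  have hV : ∀ d, (Nat.card (V d) : ℚ) = (((numIrred K d).choose (typeOfMap f d).card : ℚ) *
      (((typeOfMap f d).card.factorial : ℚ) /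
        ∏ p ∈ (typeOfMap f d).toFinset, (((typeOfMap f d).count p).factorial : ℚ))) := fun d => by
    rw [← card_irredOfDegree]
    refine card_functions 0 (zero_notMem_typeOfMap f d) (u := fun a => f a.1) fun p hp => ?_
    rw [card_irredOfDegree_fiber hX d hp, count_typeOfMap f d hp]
  let F : {f' : MonicIrred K →₀ IntPartition // f' (MonicIrred.X K) = 0 ∧
      typeOfMap f' = typeOfMap f} → ∀ d : Finset.Icc 1 n, V d := fun f' d =>
    ⟨fun a => f'.1 a.1, fun p hp => by
      rw [card_irredOfDegree_fiber f'.2.1 d hp, ← count_typeOfMap f'.1 d hp, f'.2.2]⟩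
  have hF : Function.Bijective F := by
    constructor
    · intro f₁ f₂ h
      refine Subtype.ext (Finsupp.ext fun φ => ?_)
      by_cases hφ : φ = MonicIrred.X K
      · rw [hφ, f₁.2.1, f₂.2.1]
      by_cases hd : φ.1.natDegree ∈ Finset.Icc 1 n
      · exact congrFun (congrArg Subtype.val (congrFun h ⟨_, hd⟩)) ⟨φ, rfl, hφ⟩
      · have h0 : ∀ f' : {f' : MonicIrred K →₀ IntPartition // f' (MonicIrred.X K) = 0 ∧
            typeOfMap f' = typeOfMap f}, f'.1 φ = 0 := fun f' => by
          by_contra hne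
          exact hd (natDegree_mem_Icc ((sum_eq_of_typeOfMap_eq f'.2.2).trans hn)
            (Finsupp.mem_support_iff.2 hne))
        rw [h0, h0]
    · intro v
      let g : MonicIrred K → IntPartition := fun φ =>
        if h : φ.1.natDegree ∈ Finset.Icc 1 n ∧ φ ≠ MonicIrred.X K then
          (v ⟨_, h.1⟩).1 ⟨φ, rfl, h.2⟩ else 0
      have hg : ∀ (d : ℕ) (hd : d ∈ Finset.Icc 1 n) (a : IrredOfDegree K d),
          g a.1 = (v ⟨d, hd⟩).1 a := by
        rintro d hd ⟨φ, hφd, hφ⟩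
        subst hφd
        exact dif_pos ⟨hd, hφ⟩
      have hgX : g (MonicIrred.X K) = 0 := dif_neg fun h => h.2 rfl
      have hfin : (Function.support g).Finite := by
        have : Finite (Σ d : Finset.Icc 1 n, {φ : MonicIrred K // φ.1.natDegree = d.1}) :=
          inferInstance
        refine (Set.finite_range fun x : Σ d : Finset.Icc 1 n,
          {φ : MonicIrred K // φ.1.natDegree = d.1} => x.2.1).subset fun φ hφ => ?_
        by_cases h : φ.1.natDegree ∈ Finset.Icc 1 n
        · exact ⟨⟨⟨_, h⟩, ⟨φ, rfl⟩⟩, rfl⟩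
        · exact absurd (dif_neg fun h' => h h'.1) hφ
      have htype : typeOfMap (Finsupp.ofSupportFinite g hfin) = typeOfMap f := by
        rw [typeOfMap_eq_iff _ _ (zero_notMem_typeOfMap f)]
        intro d p hp
        by_cases hd : d ∈ Finset.Icc 1 n
        · rw [← card_irredOfDegree_fiber (f := Finsupp.ofSupportFinite g hfin) hgX d hp,
            ← (v ⟨d, hd⟩).2 p hp]
          refine Nat.card_congr (Equiv.subtypeEquivRight fun a => ?_)
          rw [← hg d hd a]
          rfl
        · rw [count_typeOfMap f d hp]
          have h1 : IsEmpty {φ : MonicIrred K // φ.1.natDegree = d ∧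
              Finsupp.ofSupportFinite g hfin φ = p} := ⟨fun φ => hp <| by
            rw [← φ.2.2]
            exact dif_neg fun h' => hd (φ.2.1 ▸ h'.1)⟩
          have h2 : IsEmpty {φ : MonicIrred K // φ.1.natDegree = d ∧ f φ = p} := ⟨fun φ => hd <| by
            rw [← φ.2.1]
            exact natDegree_mem_Icc hn (Finsupp.mem_support_iff.2 (by rw [φ.2.2]; exact hp))⟩
          rw [Nat.card_of_isEmpty, Nat.card_of_isEmpty]
      exact ⟨⟨_, hgX, htype⟩, funext fun d => Subtype.ext (funext fun a => hg d.1 d.2 a)⟩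
  rw [Nat.card_congr (Equiv.ofBijective F hF), Nat.card_pi, Nat.cast_prod, numClasses,
    Finset.prod_coe_sort (Finset.Icc 1 n) fun d => (Nat.card (V d) : ℚ)]
  exact Finset.prod_congr rfl fun d _ => hV d

end Types

end GLDoubleCosets
end

/-! ### Burnside's lemma, class sizes and intersections with block subgroups -/

noncomputable section
namespace GLDoubleCosets

section Burnside

variable {G : Type*} [Group G]

/-- The action of `H × L` on `G` whose orbits are the `(H, L)`-double cosets. -/
abbrev doubleCosetAction (H L : Subgroup G) : MulAction (H × L) G where
  smul x g := x.1 * g * (x.2 : G)⁻¹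
  one_smul g := by
    change ((1 : H) : G) * g * ((1 : L) : G)⁻¹ = g
    simp
  mul_smul x y g := by
    change ((x.1 * y.1 : H) : G) * g * ((x.2 * y.2 : L) : G)⁻¹ = x.1 * (y.1 * g * (y.2 : G)⁻¹) * (x.2 : G)⁻¹
    simp [mul_assoc]

theorem card_doubleCoset_mul [Finite G] (H L : Subgroup G) [Fintype H] [Fintype L] :
    Nat.card (DoubleCoset.Quotient (H : Set G) (L : Set G)) * (Nat.card H * Nat.card L) =
      ∑ h : H, ∑ l : L, Nat.card {x : G // x * l = h * x} := by
  let _ := doubleCosetAction H L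
  have hsmul : ∀ (x : H × L) (g : G), x • g = x.1 * g * (x.2 : G)⁻¹ := fun _ _ => rfl
  have e : DoubleCoset.Quotient (H : Set G) (L : Set G) ≃
      Quotient (MulAction.orbitRel (H × L) G) :=
    Quotient.congrRight fun x y => by
      rw [MulAction.orbitRel_apply, DoubleCoset.rel_iff]
      constructor
      · rintro ⟨a, ha, b, hb, rfl⟩
        refine ⟨(⟨a, ha⟩⁻¹, ⟨b, hb⟩), ?_⟩
        simp only [hsmul]
        simp [mul_assoc]
      · rintro ⟨⟨a, b⟩, rfl⟩
        refine ⟨a.1⁻¹, inv_mem a.2, b.1, b.2, ?_⟩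
        simp only [hsmul]
        simp [mul_assoc]
  rw [Nat.card_congr e, ← Nat.card_prod H L, ← Nat.card_prod,
    ← Nat.card_congr (MulAction.sigmaFixedByEquivOrbitsProdGroup (H × L) G), Nat.card_sigma,
    Fintype.sum_prod_type]
  refine Finset.sum_congr rfl fun h _ => Finset.sum_congr rfl fun l _ => ?_
  refine Nat.card_congr (Equiv.subtypeEquivRight fun x => ?_)
  rw [MulAction.mem_fixedBy, hsmul, mul_inv_eq_iff_eq_mul, eq_comm]

end Burnside

variable {K : Type*} [Field K] {n : ℕ}

theorem blockEmbedding_injective (c : Composition n) :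
    Function.Injective (blockEmbedding K c) := by
  refine (Units.map_injective ?_).comp MulEquiv.piUnits.symm.injective
  exact (Matrix.reindexRingEquiv K c.blocksFinEquiv).injective.comp
    Matrix.blockDiagonal'_injective

variable [Finite K]

theorem isConj_of_mul_eq {G : Type*} [Group G] {c g h : G} (hc : c * g = h * c) : IsConj g h :=
  isConj_iff.2 ⟨c, by rw [hc, mul_inv_cancel_right]⟩

/-- The map `c ↦ c g c⁻¹` sends `GL_n` onto the class of `g`, and all its fibres have the order of
the centralizer. -/
theorem card_classMap_fiber_mul (g : GL (Fin n) K) :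
    (Nat.card {h : GL (Fin n) K // classMap (h : Matrix (Fin n) (Fin n) K) =
      classMap (g : Matrix (Fin n) (Fin n) K)} : ℚ) *
      ((classMap (g : Matrix (Fin n) (Fin n) K)).prod fun φ p => cd (Nat.card K) φ.1.natDegree p) =
    Nat.card (GL (Fin n) K) := by
  let E : GL (Fin n) K ≃ Σ h : {h : GL (Fin n) K // classMap (h : Matrix (Fin n) (Fin n) K) =
      classMap (g : Matrix (Fin n) (Fin n) K)}, {c : GL (Fin n) K // c * g = h.1 * c} :=
    { toFun := fun c => ⟨⟨c * g * c⁻¹, ((isConj_iff_classMap_eq _ _).1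
        (isConj_iff.2 ⟨c, rfl⟩)).symm⟩, ⟨c, (inv_mul_cancel_right _ _).symm⟩⟩
      invFun := fun x => x.2.1
      left_inv := fun _ => rfl
      right_inv := by
        rintro ⟨⟨h, hh⟩, c, hc⟩
        refine Sigma.subtype_ext (Subtype.ext ?_) rfl
        change c * g * c⁻¹ = h
        rw [mul_inv_eq_iff_eq_mul, hc] }
  have := Fintype.ofFinite {h : GL (Fin n) K // classMap (h : Matrix (Fin n) (Fin n) K) =
      classMap (g : Matrix (Fin n) (Fin n) K)}
  rw [Nat.card_congr E, Nat.card_sigma, Nat.cast_sum,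
    Finset.sum_congr rfl fun h _ => card_conjugators h.2.symm, Finset.sum_const, nsmul_eq_mul,
    Finset.card_univ, ← Nat.card_eq_fintype_card]

/-- Realizability and the centralizer order depend only on the type and the value at `X`, so the two
fibres are both empty or have equal size. -/
theorem card_classMap_fiber_congr {f f' : MonicIrred K →₀ IntPartition}
    (hX : f (MonicIrred.X K) = f' (MonicIrred.X K)) (h : typeOfMap f = typeOfMap f') :
    Nat.card {g : GL (Fin n) K // classMap (g : Matrix (Fin n) (Fin n) K) = f} =
      Nat.card {g : GL (Fin n) K // classMap (g : Matrix (Fin n) (Fin n) K) = f'} := by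
  have hex : ∀ {f f' : MonicIrred K →₀ IntPartition}, f (MonicIrred.X K) = f' (MonicIrred.X K) →
      typeOfMap f = typeOfMap f' →
      (∃ g : GL (Fin n) K, classMap (g : Matrix (Fin n) (Fin n) K) = f) →
      ∃ g : GL (Fin n) K, classMap (g : Matrix (Fin n) (Fin n) K) = f' := by
    rintro _ f' hX h ⟨g, rfl⟩
    exact exists_classMap_eq f' (by rw [← hX, classMap_X])
      (by rw [← sum_eq_of_typeOfMap_eq h, size_classMap])
  by_cases hf : ∃ g : GL (Fin n) K, classMap (g : Matrix (Fin n) (Fin n) K) = f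
  · obtain ⟨g', rfl⟩ := hex hX h hf
    obtain ⟨g, rfl⟩ := hf
    have h1 := card_classMap_fiber_mul g
    have h2 := card_classMap_fiber_mul g'
    rw [← prod_eq_of_typeOfMap_eq (cd (Nat.card K)) h, ← h1] at h2
    refine (Nat.cast_injective (R := ℚ) (mul_right_cancel₀ (fun h0 => ?_) h2)).symm
    rw [h0, mul_zero] at h1
    exact Nat.card_pos.ne (Nat.cast_injective (R := ℚ) (by rw [← h1, Nat.cast_zero]))
  · have h1 : IsEmpty {g : GL (Fin n) K // classMap (g : Matrix (Fin n) (Fin n) K) = f} :=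
      ⟨fun g => hf ⟨g.1, g.2⟩⟩
    have h2 : IsEmpty {g : GL (Fin n) K // classMap (g : Matrix (Fin n) (Fin n) K) = f'} :=
      ⟨fun g => hf (hex hX.symm h.symm ⟨g.1, g.2⟩)⟩
    rw [Nat.card_of_isEmpty, Nat.card_of_isEmpty]

/-- Fibres of the class map over `f` and over its relabelling have equal size, so a bijection exists
fibre by fibre; it need not respect multiplication. -/
theorem exists_equiv_classMap_equivMapDomain (σ : Equiv.Perm (MonicIrred K))
    (hσ : ∀ φ, (σ φ).1.natDegree = φ.1.natDegree) (hX : σ (MonicIrred.X K) = MonicIrred.X K)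
    (m : ℕ) :
    ∃ E : GL (Fin m) K ≃ GL (Fin m) K, ∀ g, classMap (E g : Matrix (Fin m) (Fin m) K) =
      (classMap (g : Matrix (Fin m) (Fin m) K)).equivMapDomain σ := by
  refine exists_equiv_comp_eq
    (fun g : GL (Fin m) K => (classMap (g : Matrix (Fin m) (Fin m) K)).equivMapDomain σ)
    (fun g : GL (Fin m) K => classMap (g : Matrix (Fin m) (Fin m) K)) fun f => ?_
  have hf : (f.equivMapDomain σ.symm).equivMapDomain σ = f := by
    ext1 φ
    simp [Finsupp.equivMapDomain_apply]
  have h1 : Nat.card {g : GL (Fin m) K //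
      (classMap (g : Matrix (Fin m) (Fin m) K)).equivMapDomain σ = f} =
      Nat.card {g : GL (Fin m) K //
        classMap (g : Matrix (Fin m) (Fin m) K) = f.equivMapDomain σ.symm} := by
    refine Nat.card_congr (Equiv.subtypeEquivRight fun g => ⟨?_, fun h => by rw [h, hf]⟩)
    rintro rfl
    ext1 φ
    simp [Finsupp.equivMapDomain_apply]
  rw [h1]
  refine card_classMap_fiber_congr ?_ ?_
  · rw [Finsupp.equivMapDomain_apply, Equiv.symm_symm, hX]
  · refine typeOfMap_equivMapDomain σ.symm (fun φ => ?_) f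
    rw [← hσ, Equiv.apply_symm_apply]

theorem card_GLpart_inter (ν : n.Partition) (g : GL (Fin n) K) :
    Nat.card {h : GL (Fin n) K // h ∈ GLpart K ν ∧ IsConj g h} =
      Nat.card {h : (i : Fin (toComposition ν).length) → GL (Fin ((toComposition ν).blocksFun i)) K //
        ∑ i, classMap (h i : Matrix (Fin ((toComposition ν).blocksFun i))
          (Fin ((toComposition ν).blocksFun i)) K) = classMap (g : Matrix (Fin n) (Fin n) K)} := by
  have hiff := fun h : (i : Fin (toComposition ν).length) →
      GL (Fin ((toComposition ν).blocksFun i)) K => by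
    have := isConj_iff_classMap_eq g (blockEmbedding K (toComposition ν) h)
    rw [classMap_blockEmbedding, eq_comm] at this
    exact this
  refine (Nat.card_congr (Equiv.ofBijective
    (fun h => ⟨blockEmbedding K (toComposition ν) h.1, ⟨h.1, rfl⟩, (hiff h.1).2 h.2⟩)
    ⟨fun h h' hh => ?_, ?_⟩)).symm
  · exact Subtype.ext (blockEmbedding_injective _ (congrArg Subtype.val hh))
  · rintro ⟨_, ⟨h, rfl⟩, hc⟩
    exact ⟨⟨h, (hiff h).1 hc⟩, rfl⟩

/-- Membership in the class is a condition on the sum of the class maps of the blocks. Relabelling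
by `σ` commutes with sums, so the bijections `E`, applied blockwise, carry one solution set to the
other. -/
theorem card_GLpart_inter_congr (ν : n.Partition) {g g' : GL (Fin n) K}
    (h : classType g = classType g') :
    Nat.card {h : GL (Fin n) K // h ∈ GLpart K ν ∧ IsConj g h} =
      Nat.card {h : GL (Fin n) K // h ∈ GLpart K ν ∧ IsConj g' h} := by
  obtain ⟨σ, hσ, hX, hσf⟩ := exists_perm_of_typeOfMap_eq (classMap_X g') (classMap_X g) h.symm
  have hg : (classMap (g : Matrix (Fin n) (Fin n) K)).equivMapDomain σ =
      classMap (g' : Matrix (Fin n) (Fin n) K) := by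
    ext1 φ
    rw [Finsupp.equivMapDomain_apply, ← hσf, Equiv.apply_symm_apply]
  rw [card_GLpart_inter, card_GLpart_inter]
  choose E hE using exists_equiv_classMap_equivMapDomain (K := K) σ hσ hX
  refine Nat.card_congr ((Equiv.piCongrRight fun i => E _).subtypeEquiv fun x => ?_)
  simp only [Equiv.piCongrRight_apply, Pi.map_apply, hE]
  rw [← hg]
  constructor
  · intro hx
    rw [← hx]
    ext1 φ
    simp [Finsupp.equivMapDomain_apply, Finsupp.finsetSum_apply]
  · intro hx
    ext1 φ
    have := DFunLike.congr_fun hx (σ φ)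
    simpa [Finsupp.equivMapDomain_apply, Finsupp.finsetSum_apply] using this

theorem classType_eq_of_isConj {g h : GL (Fin n) K} (hgh : IsConj g h) :
    classType g = classType h := by
  rw [classType, classType, (isConj_iff_classMap_eq g h).1 hgh]

/-- Conjugacy classes correspond to realizable maps, so the count is that of `card_maps_of_type`. -/
theorem card_classes_of_type (g : GL (Fin n) K) :
    (Nat.card {C : ConjClasses (GL (Fin n) K) //
      ∃ h, ConjClasses.mk h = C ∧ classType h = classType g} : ℚ) =
      numClasses K n (classType g) := by
  have hout : ∀ C : ConjClasses (GL (Fin n) K), ConjClasses.mk (Quotient.out C) = C :=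
    fun C => Quotient.out_eq C
  rw [classType, ← card_maps_of_type n _ (classMap_X g) (size_classMap _)]
  congr 1
  refine Nat.card_congr (Equiv.ofBijective (fun C =>
    ⟨classMap (Quotient.out C.1 : GL (Fin n) K).1, classMap_X _, ?_⟩) ⟨fun C C' h => ?_, ?_⟩)
  · obtain ⟨_, h, rfl, ht⟩ := C
    exact (classType_eq_of_isConj (ConjClasses.mk_eq_mk_iff_isConj.1 (hout _))).trans ht
  · refine Subtype.ext ?_
    rw [← hout C.1, ← hout C'.1, ConjClasses.mk_eq_mk_iff_isConj, isConj_iff_classMap_eq]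
    exact congrArg Subtype.val h
  · rintro ⟨f, hX, ht⟩
    obtain ⟨h, rfl⟩ := exists_classMap_eq (n := n) f hX
      (by rw [sum_eq_of_typeOfMap_eq ht, size_classMap])
    refine ⟨⟨ConjClasses.mk h, h, rfl, ht⟩, Subtype.ext ?_⟩
    exact (isConj_iff_classMap_eq _ _).1 (ConjClasses.mk_eq_mk_iff_isConj.1 (hout _))

theorem prod_cd_classMap (g : GL (Fin n) K) :
    ((classMap (g : Matrix (Fin n) (Fin n) K)).prod fun φ p => cd (Nat.card K) φ.1.natDegree p) =
      centralizerOrder (Nat.card K) n (classType g) :=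
  prod_eq_prod_typeOfMap (cd (Nat.card K)) _ _ fun _ hφ => natDegree_mem_Icc (size_classMap _) hφ

theorem card_conjugators_eq_ite (g h : GL (Fin n) K)
    [Decidable (ConjClasses.mk g = ConjClasses.mk h)] :
    (Nat.card {c : GL (Fin n) K // c * g = h * c} : ℚ) =
      if ConjClasses.mk g = ConjClasses.mk h then
        centralizerOrder (Nat.card K) n (classType g) else 0 := by
  split_ifs with hc
  · rw [ConjClasses.mk_eq_mk_iff_isConj, isConj_iff_classMap_eq] at hc
    rw [card_conjugators hc, prod_cd_classMap]
  · have : IsEmpty {c : GL (Fin n) K // c * g = h * c} :=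
      ⟨fun c => hc (ConjClasses.mk_eq_mk_iff_isConj.2 (isConj_of_mul_eq c.2))⟩
    rw [Nat.card_of_isEmpty, Nat.cast_zero]

theorem card_doubleCoset_mul_eq_sum_classes (H L : Subgroup (GL (Fin n) K))
    [Fintype (ConjClasses (GL (Fin n) K))] :
    (Nat.card (DoubleCoset.Quotient (H : Set (GL (Fin n) K)) (L : Set (GL (Fin n) K))) : ℚ) *
        (Nat.card H * Nat.card L) =
      ∑ C : ConjClasses (GL (Fin n) K), (Nat.card {h // h ∈ H ∧ IsConj (Quotient.out C) h} : ℚ) *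
        Nat.card {h // h ∈ L ∧ IsConj (Quotient.out C) h} *
          centralizerOrder (Nat.card K) n (classType (Quotient.out C : GL (Fin n) K)) := by
  classical
  have := Fintype.ofFinite H
  have := Fintype.ofFinite L
  have hout : ∀ (C : ConjClasses (GL (Fin n) K)) (h : GL (Fin n) K),
      IsConj (Quotient.out C) h ↔ ConjClasses.mk h = C := fun C h => by
    rw [← ConjClasses.mk_eq_mk_iff_isConj, eq_comm]
    exact Eq.congr_right (Quotient.out_eq C)
  have hcard : ∀ (H : Subgroup (GL (Fin n) K)) [Fintype H] (C : ConjClasses (GL (Fin n) K)),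
      (Nat.card {h // h ∈ H ∧ IsConj (Quotient.out C) h} : ℚ) =
        ∑ h : H, if ConjClasses.mk h.1 = C then 1 else 0 := fun H _ C => by
    rw [Finset.sum_boole, ← Fintype.card_subtype, ← Nat.card_eq_fintype_card]
    congr 1
    refine Nat.card_congr ((Equiv.subtypeEquivRight fun h => ?_).trans
      (Equiv.subtypeSubtypeEquivSubtypeInter (fun h => h ∈ H)
        (fun h => ConjClasses.mk h = C)).symm)
    rw [hout]
  have h1 := congrArg (Nat.cast (R := ℚ)) (card_doubleCoset_mul H L)
  push_cast at h1
  rw [h1]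
  simp only [hcard, card_conjugators_eq_ite]
  simp_rw [Finset.sum_mul_sum, Finset.sum_mul]
  refine (Finset.sum_comm.trans (Finset.sum_congr rfl fun h _ =>
    Finset.sum_comm.trans (Finset.sum_congr rfl fun l _ => ?_))).symm
  -- For a fixed pair `(h, l)` only the class of `l` can contribute, and it does so exactly when `h`
  -- lies in it.
  rw [Finset.sum_eq_single (ConjClasses.mk l.1)]
  · have ht := classType_eq_of_isConj ((hout (ConjClasses.mk l.1) l.1).2 rfl)
    rw [ht]
    simp only [if_true, mul_one, ite_mul, one_mul, zero_mul, eq_comm]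
  · intro C _ hC
    rw [if_neg (fun h => hC h.symm) (α := ℚ) (c := ConjClasses.mk l.1 = C), mul_zero, zero_mul]
  · simp

end GLDoubleCosets
end

/-! ### Assembly of the three statements -/

open GLDoubleCosets in
theorem mainTheorem2 (K : Type*) [Field K] [Finite K] (n : ℕ) :
    -- `N_t` is the number of conjugacy classes of type `t` in `GL_n(K)`
    (∀ t ∈ GLDoubleCosets.classTypes K n,
      (Nat.card {C : ConjClasses (GL (Fin n) K) //
          ∃ g, ConjClasses.mk g = C ∧ GLDoubleCosets.classType g = t} : ℚ)
        = GLDoubleCosets.numClasses K n t) ∧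
    -- `a t ν` is the number of elements of `GL_ν(K)` in any conjugacy class of type `t`
    ∃ a : GLDoubleCosets.ClassType → n.Partition → ℕ,
      (∀ (ν : n.Partition) (g : GL (Fin n) K),
        Nat.card {h : GL (Fin n) K // h ∈ GLDoubleCosets.GLpart K ν ∧ IsConj g h}
          = a (GLDoubleCosets.classType g) ν) ∧
      ∀ lam mu : n.Partition,
        (Nat.card (DoubleCoset.Quotient
            (GLDoubleCosets.GLpart K lam : Set (GL (Fin n) K))
            (GLDoubleCosets.GLpart K mu : Set (GL (Fin n) K))) : ℚ)
          = 1 / ((Nat.card (GLDoubleCosets.GLpart K lam) : ℚ)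
                * (Nat.card (GLDoubleCosets.GLpart K mu) : ℚ))
            * ∑ t ∈ GLDoubleCosets.classTypes K n,
                GLDoubleCosets.numClasses K n t * (a t lam : ℚ) * (a t mu : ℚ)
                  * GLDoubleCosets.centralizerOrder (Nat.card K) n t := by
  classical
  have hN : ∀ t ∈ classTypes K n, (Nat.card {C : ConjClasses (GL (Fin n) K) //
      ∃ g, ConjClasses.mk g = C ∧ classType g = t} : ℚ) = numClasses K n t := by
    intro t ht
    obtain ⟨g, rfl⟩ := (Set.Finite.mem_toFinset _).1 ht
    exact card_classes_of_type g
  -- The value is read off any element of type `t`; by (2) the choice is immaterial. The default 0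
  -- is taken only at sequences that are not types.
  let a : ClassType → n.Partition → ℕ := fun t ν =>
    if h : ∃ g : GL (Fin n) K, classType g = t then
      Nat.card {x : GL (Fin n) K // x ∈ GLpart K ν ∧ IsConj h.choose x} else 0
  have ha : ∀ (ν : n.Partition) (g : GL (Fin n) K),
      Nat.card {h : GL (Fin n) K // h ∈ GLpart K ν ∧ IsConj g h} = a (classType g) ν := by
    intro ν g
    have h : ∃ g' : GL (Fin n) K, classType g' = classType g := ⟨g, rfl⟩
    rw [show a (classType g) ν = _ from dif_pos h]
    exact card_GLpart_inter_congr ν h.choose_spec.symm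
  refine ⟨hN, a, ha, fun lam mu => ?_⟩
  have := Fintype.ofFinite (ConjClasses (GL (Fin n) K))
  have hpos : ∀ ν : n.Partition, (Nat.card (GLpart K ν) : ℚ) ≠ 0 := fun ν =>
    Nat.cast_ne_zero.2 Nat.card_pos.ne'
  rw [one_div, eq_inv_mul_iff_mul_eq₀ (mul_ne_zero (hpos lam) (hpos mu)), mul_comm,
    card_doubleCoset_mul_eq_sum_classes]
  simp only [ha]
  -- Classes are grouped by type: the summand is constant on each group, and by (1) the group has
  -- `N_t` members.
  rw [← Finset.sum_fiberwise_of_maps_to (s := Finset.univ) (t := classTypes K n)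
    (g := fun C : ConjClasses (GL (Fin n) K) => classType (Quotient.out C : GL (Fin n) K))
    fun C _ => (Set.Finite.mem_toFinset _).2 ⟨_, rfl⟩]
  refine Finset.sum_congr rfl fun t ht => ?_
  rw [Finset.sum_congr rfl fun C hC => by rw [(Finset.mem_filter.1 hC).2], Finset.sum_const,
    nsmul_eq_mul, ← hN t ht, ← Fintype.card_subtype, ← Nat.card_eq_fintype_card]
  simp only [mul_assoc]
  congr 2
  refine Nat.card_congr (Equiv.subtypeEquivRight fun C => ⟨fun h => ⟨_, Quotient.out_eq C, h⟩, ?_⟩)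
  rintro ⟨g, rfl, rfl⟩
  exact classType_eq_of_isConj (ConjClasses.mk_eq_mk_iff_isConj.1
    (Quotient.out_eq (ConjClasses.mk g)))
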